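/- Let $d\ge 1$ and let $\mathcal P^d$ be the space of finite real linear combinations of indicator functions $[P]$ of convex polyhedra $P\subset\mathbf R^d$ (finite intersections of closed half-spaces, possibly unbounded), functions that agree almost everywhere being identified. The Fourier--Laplace transform $f\mapsto\widehat f$ is the unique linear map from $\mathcal P^d$ to the meromorphic functions on $\mathbf C^d$ such that $\widehat{[P]}=0$ if the convex polyhedron $P$ contains a straight line, and otherwise $\widehat{[P]}(\mathbf z)=\int_P e^{\langle \mathbf z,\mathbf x\rangle}\,d\mathbf x$ for all $\mathbf z\in\mathbf C^d$ for which the integral converges absolutely, where $\langle\mathbf z,\mathbf x\rangle=\sum_j z_jx_j$. For an oriented hyperplane $h\subset\mathbf R^d$ with unit normal vector $\mathbf n_h$, the signed section of $f$ by $h$ is the function on $h$ $$f_h(\mathbf x)=\lim_{\varepsilon\to0^+}f(\mathbf x+\varepsilon\mathbf n_h)-\lim_{\varepsilon\to0^+}f(\mathbf x-\varepsilon\mathbf n_h),$$ where $f$ is represented by a linear combination of indicator functions of polyhedra; it belongs to the algebra $\mathcal P^{d-1}$ of the $(d-1)$-dimensional Euclidean space $h$, whose origin is taken at the point of $h$ closest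 to the origin of $\mathbf R^d$ (another choice of origin multiplies the transform by a nowhere vanishing exponential). On a $0$-dimensional space, integration is evaluation at the point. **Theorem.** For every $f\in\mathcal P^d$, the Fourier--Laplace transform $\widehat f$ vanishes identically if and only if, for every oriented hyperplane $h\subset\mathbf R^d$ (not necessarily through the origin), the $(d-1)$-dimensional Fourier--Laplace transform $\widehat{f_h}$ of the signed section $f_h$ vanishes identically. -/

import Mathlib

open MeasureTheory Filter Topology
open scoped RealInnerProductSpace

namespace PolyhedraAlgebra

/-- A convex polyhedron (possibly unbounded): the intersection of finitely many closed half-spaces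
`{x | ⟪a, x⟫ ≤ b}`. (A pair with `a = 0` contributes either the whole space or the empty set.) -/
def IsPolyhedron {E : Type*} [NormedAddCommGroup E] [InnerProductSpace ℝ E] (P : Set E) : Prop :=
  ∃ s : Finset (E × ℝ), P = {x | ∀ ab ∈ s, ⟪ab.1, x⟫ ≤ ab.2}

/-- The indicator function `[P]` of a set. -/
noncomputable def indicatorFn {E : Type*} (P : Set E) : E → ℝ :=
  P.indicator fun _ => 1

/-- The polyhedral functions on `E`: real linear combinations of indicator functions of convex
polyhedra. The algebra of polyhedra consists of the classes of these functions modulo equality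
almost everywhere. -/
def polyhedralFunctions (E : Type*) [NormedAddCommGroup E] [InnerProductSpace ℝ E] :
    Submodule ℝ (E → ℝ) :=
  Submodule.span ℝ {g | ∃ P : Set E, IsPolyhedron P ∧ g = indicatorFn P}

/-- `P` contains a straight line. -/
def ContainsLine {E : Type*} [NormedAddCommGroup E] [InnerProductSpace ℝ E] (P : Set E) : Prop :=
  ∃ x w : E, w ≠ 0 ∧ ∀ t : ℝ, x + t • w ∈ P

/-- The ring of entire functions on the space `E →L[ℝ] ℂ` of complex frequencies. A frequency
`z ∈ ℂ^d` is the real-linear functional `x ↦ ⟨z, x⟩ = ∑ zⱼ xⱼ`; these functionals form a complex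
vector space of dimension `dim E`. -/
def entireFunctions (E : Type*) [NormedAddCommGroup E] [InnerProductSpace ℝ E] :
    Subalgebra ℂ ((E →L[ℝ] ℂ) → ℂ) where
  carrier := {g | AnalyticOnNhd ℂ g Set.univ}
  mul_mem' ha hb := ha.mul hb
  add_mem' ha hb := ha.add hb
  algebraMap_mem' _ := analyticOnNhd_const

/-- Meromorphic functions on the space of complex frequencies, as quotients of entire
functions. -/
abbrev MeromorphicFunctions (E : Type*) [NormedAddCommGroup E] [InnerProductSpace ℝ E] : Type _ :=
  FractionRing (entireFunctions E)

/-- `F` is the Fourier–Laplace transform of the convex polyhedron `P`. If `P` contains a line, this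
means `F = 0`. Otherwise it means that `F = p / q` is a meromorphic function which equals
`∫_P e^⟨z,x⟩ dx` at every `z` where this integral converges absolutely. -/
def IsPolyhedronTransform {E : Type*} [NormedAddCommGroup E] [InnerProductSpace ℝ E]
    [FiniteDimensional ℝ E] [MeasurableSpace E] [BorelSpace E]
    (P : Set E) (F : MeromorphicFunctions E) : Prop :=
  (ContainsLine P ∧ F = 0) ∨
  (¬ ContainsLine P ∧ ∃ p q : entireFunctions E, q ≠ 0 ∧
    F * algebraMap (entireFunctions E) (MeromorphicFunctions E) q =
      algebraMap (entireFunctions E) (MeromorphicFunctions E) p ∧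
    ∀ z : E →L[ℝ] ℂ, IntegrableOn (fun x => Complex.exp (z x)) P volume →
      (q : (E →L[ℝ] ℂ) → ℂ) z * ∫ x in P, Complex.exp (z x) = (p : (E →L[ℝ] ℂ) → ℂ) z)

/-- The graph of the Fourier–Laplace transform: the linear extension of the transform of convex
polyhedra to the algebra of polyhedra, where functions that agree almost everywhere are
identified. -/
def transformGraph (E : Type*) [NormedAddCommGroup E] [InnerProductSpace ℝ E]
    [FiniteDimensional ℝ E] [MeasurableSpace E] [BorelSpace E] :
    Submodule ℝ ((E → ℝ) × MeromorphicFunctions E) :=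
  Submodule.span ℝ
    ({gF | ∃ P : Set E, IsPolyhedron P ∧ gF.1 = indicatorFn P ∧ IsPolyhedronTransform P gF.2} ∪
     {gF | gF.1 =ᵐ[volume] (fun _ => (0 : ℝ)) ∧ gF.2 = 0})

open scoped Classical in
/-- The Fourier–Laplace transform of `f`, a meromorphic function: the value at `f` of the linear
extension. It is set to `0` for functions which are not almost everywhere equal to a polyhedral
function. -/
noncomputable def fourierLaplace {E : Type*} [NormedAddCommGroup E] [InnerProductSpace ℝ E]
    [FiniteDimensional ℝ E] [MeasurableSpace E] [BorelSpace E] (f : E → ℝ) :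
    MeromorphicFunctions E :=
  if hf : ∃ F, (f, F) ∈ transformGraph E then hf.choose else 0

/-- An oriented hyperplane `{x | ⟪normal, x⟫ = offset}` with its unit normal vector. -/
structure OrientedHyperplane (E : Type*) [NormedAddCommGroup E] [InnerProductSpace ℝ E] where
  normal : E
  norm_normal : ‖normal‖ = 1
  offset : ℝ

/-- The Euclidean space of dimension `dim E - 1` underlying the hyperplane `h`. -/
noncomputable abbrev OrientedHyperplane.Space {E : Type*} [NormedAddCommGroup E] [InnerProductSpace ℝ E]
    (h : OrientedHyperplane E) : Submodule ℝ E :=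
  (Submodule.span ℝ {h.normal})ᗮ

/-- The isometric parametrization of the hyperplane `h` that sends `0` to the point of `h` closest
to the origin. -/
def OrientedHyperplane.param {E : Type*} [NormedAddCommGroup E] [InnerProductSpace ℝ E]
    (h : OrientedHyperplane E) (y : h.Space) : E :=
  h.offset • h.normal + (y : E)

/-- The signed section of `f` by the oriented hyperplane `h`: at a point `x` of `h` it is
`lim_{ε → 0+} f (x + ε n) - lim_{ε → 0+} f (x - ε n)`, with `n` the unit normal. -/
noncomputable def signedSection {E : Type*} [NormedAddCommGroup E] [InnerProductSpace ℝ E]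
    (f : E → ℝ) (h : OrientedHyperplane E) : h.Space → ℝ := fun y =>
  limUnder (𝓝[>] (0 : ℝ)) (fun ε => f (h.param y + ε • h.normal)) -
    limUnder (𝓝[>] (0 : ℝ)) (fun ε => f (h.param y - ε • h.normal))

end PolyhedraAlgebra

/-! Choose a direction `v` transverse to the finitely many hyperplanes that bound the polyhedra in
`f`, and orient these so that ⟨n_h, v⟩ > 0. The derivative of `f` along `v` lives on them, with
density ⟨n_h, v⟩ f_h, so integration by parts gives z(v) f̂(z) = -∑_h ⟨n_h, v⟩ e^{z(c_h n_h)}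
f̂_h(z|_h), where c_h is the offset of `h` (`integral_stokes`, `isPolyhedronTransform_stokesSum`,
`exists_eq_stokesSum`). If all sections have zero transform, then so has `f`.

The same formula constructs the transform, by induction on the dimension. Its right side depends
only on the function `f`, not on a decomposition into polyhedra, and is zero when `f` vanishes
almost everywhere. It is also zero for polyhedra that contain a line. Hence the linear extension is
well defined (`HasTransform.of_sections`). It also shows that transforms are bounded along imaginary
translates of a generic frequency, being built from exponentials and reciprocals of linear forms.

For the converse let f̂ = 0 and fix h₀ with normal n₀. Evaluate the vanishing sum at z + i t n₀ and
let t → ∞. If `h` is not parallel to h₀, then n₀ has a nonzero projection `a` to `h`, and the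
formula inside `h`, with a direction pairing positively with `a`, makes the transform of f_h decay
like 1/t (`exists_boundedRep_tendsto_zero`). If `h` is parallel to h₀, the shift is invisible on
`h`, and the term only acquires the factor e^{i t c_h}. An exponential sum with distinct frequencies
thus tends to 0, so its coefficients vanish (`eq_zero_of_tendsto_sum_exp`). The coefficient of h₀ is
the transform of f_{h₀} up to a nonvanishing factor. -/

namespace PolyhedraAlgebra

/-! ### Meromorphic functions of the frequency: representation by values, and bounds along imaginary
translates. -/

section Meromorphic

variable {E : Type*} [NormedAddCommGroup E] [InnerProductSpace ℝ E]

theorem entire_eq_of_eqOn_open {p q : entireFunctions E} {O : Set (E →L[ℝ] ℂ)} (hO : IsOpen O)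
    (hne : O.Nonempty) (h : ∀ z ∈ O, p.1 z = q.1 z) : p = q := by
  obtain ⟨z, hz⟩ := hne
  exact Subtype.ext (AnalyticOnNhd.eq_of_eventuallyEq p.2 q.2 (z₀ := z)
    (Filter.eventually_of_mem (hO.mem_nhds hz) h))

theorem continuous_entire (p : entireFunctions E) : Continuous p.1 := by
  have := AnalyticOnNhd.continuousOn p.2
  exact continuousOn_univ.1 this

noncomputable scoped instance : CommRing (entireFunctions E) := Subalgebra.toCommRing _

noncomputable scoped instance : Algebra ℂ (entireFunctions E) := Subalgebra.algebra _

noncomputable scoped instance : Algebra ℝ (entireFunctions E) := Subalgebra.algebra' _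

-- By the identity theorem: if `p` is nonzero somewhere, it is nonzero on an open set, where `q`
-- must vanish, so `q` vanishes everywhere.
scoped instance : IsDomain (entireFunctions E) := by
  have : NoZeroDivisors (entireFunctions E) := by
    refine ⟨fun {p q} hpq => ?_⟩
    by_contra! hcon
    obtain ⟨z, hz⟩ : ∃ z, p.1 z ≠ 0 := by
      by_contra! h
      exact hcon.1 (Subtype.ext (funext h))
    refine hcon.2 (entire_eq_of_eqOn_open (O := {w | p.1 w ≠ 0})
      (isOpen_ne_fun (continuous_entire p) continuous_const) ⟨z, hz⟩ fun w hw => ?_)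
    have : p.1 w * q.1 w = 0 := congrFun (congrArg Subtype.val hpq) w
    exact (mul_eq_zero.1 this).resolve_left hw
  exact NoZeroDivisors.to_isDomain _

noncomputable scoped instance : SMul ℝ (MeromorphicFunctions E) := Algebra.toSMul

noncomputable scoped instance : Field (MeromorphicFunctions E) := FractionRing.field _

noncomputable scoped instance : CommRing (MeromorphicFunctions E) := Field.toCommRing

noncomputable scoped instance : Add (MeromorphicFunctions E) := Distrib.toAdd

noncomputable scoped instance : Mul (MeromorphicFunctions E) := Distrib.toMul

noncomputable scoped instance : Zero (MeromorphicFunctions E) := MulZeroClass.toZero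

/-- An entire function, viewed as a meromorphic function. -/
noncomputable abbrev ofEntire (p : entireFunctions E) : MeromorphicFunctions E :=
  algebraMap (entireFunctions E) (MeromorphicFunctions E) p

theorem ofEntire_injective : Function.Injective (ofEntire (E := E)) :=
  IsFractionRing.injective _ _

theorem real_smul_eq_ofEntire_mul (c : ℝ) (F : MeromorphicFunctions E) :
    c • F = ofEntire (algebraMap ℂ (entireFunctions E) (c : ℂ)) * F := by
  rw [Algebra.smul_def, IsScalarTower.algebraMap_apply ℝ (entireFunctions E)]
  rfl

/-- Evaluation of frequencies at `v`. -/
noncomputable def evalFreq (v : E) : (E →L[ℝ] ℂ) →L[ℂ] ℂ :=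
  LinearMap.mkContinuous
    { toFun := fun z => z v
      map_add' := fun _ _ => rfl
      map_smul' := fun _ _ => rfl } ‖v‖ fun z => (z.le_opNorm v).trans_eq (mul_comm _ _)

/-- The linear form `z ↦ z v`. -/
noncomputable def linForm (v : E) : entireFunctions E :=
  ⟨fun z => z v, fun z _ => (evalFreq v).analyticAt z⟩

/-- The exponential `z ↦ exp (z x)`. -/
noncomputable def expForm (x : E) : entireFunctions E :=
  ⟨fun z => Complex.exp (z x), fun z hz => ((linForm x).2 z hz).cexp⟩

theorem linForm_ne_zero {v : E} (hv : v ≠ 0) : linForm v ≠ 0 := by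
  intro h
  have h1 : (Complex.ofRealCLM.comp (innerSL ℝ v)) v = 0 :=
    congrFun (congrArg Subtype.val h) (Complex.ofRealCLM.comp (innerSL ℝ v))
  have h2 : ((⟪v, v⟫ : ℝ) : ℂ) = 0 := h1
  exact hv (inner_self_eq_zero.1 (Complex.ofReal_eq_zero.1 h2))

/-- Restriction of frequencies to a subspace. -/
noncomputable def restrictFreq (K : Submodule ℝ E) : (E →L[ℝ] ℂ) →L[ℂ] (K →L[ℝ] ℂ) :=
  { toFun := fun z => z.comp K.subtypeL
    map_add' := fun _ _ => rfl
    map_smul' := fun _ _ => rfl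
    cont := ((ContinuousLinearMap.compL ℝ K E ℂ).flip K.subtypeL).continuous }

@[simp] theorem restrictFreq_apply (K : Submodule ℝ E) (z : E →L[ℝ] ℂ) (y : K) :
    restrictFreq K z y = z y := rfl

theorem restrictFreq_surjective [FiniteDimensional ℝ E] (K : Submodule ℝ E) :
    Function.Surjective (restrictFreq K) := fun w =>
  ⟨w.comp K.orthogonalProjectionOnto, by ext y; simp⟩

theorem analyticAt_restrictFreq (K : Submodule ℝ E) (z : E →L[ℝ] ℂ) :
    AnalyticAt ℂ (restrictFreq K) z :=
  ContinuousLinearMap.analyticAt (𝕜 := ℂ) (E := E →L[ℝ] ℂ) (F := K →L[ℝ] ℂ) (restrictFreq K) z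

/-- The pullback of entire functions along the restriction of frequencies. -/
noncomputable def pullbackEntire (K : Submodule ℝ E) : entireFunctions K →+* entireFunctions E where
  toFun p := ⟨fun z => p.1 (restrictFreq K z), fun z _ =>
    (p.2 _ (Set.mem_univ _)).comp (analyticAt_restrictFreq K z)⟩
  map_one' := rfl
  map_mul' _ _ := rfl
  map_zero' := rfl
  map_add' _ _ := rfl

theorem pullbackEntire_injective [FiniteDimensional ℝ E] (K : Submodule ℝ E) :
    Function.Injective (pullbackEntire K) := fun p q h => by
  refine Subtype.ext (funext fun w => ?_)
  obtain ⟨z, rfl⟩ := restrictFreq_surjective K w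
  exact congrFun (congrArg Subtype.val h) z

/-- The pullback of meromorphic functions along the restriction of frequencies. -/
noncomputable def pullback [FiniteDimensional ℝ E] (K : Submodule ℝ E) :
    MeromorphicFunctions K →+* MeromorphicFunctions E :=
  IsFractionRing.map (pullbackEntire_injective K)

@[simp] theorem pullback_ofEntire [FiniteDimensional ℝ E] (K : Submodule ℝ E)
    (p : entireFunctions K) : pullback K (ofEntire p) = ofEntire (pullbackEntire K p) :=
  IsLocalization.map_eq (M := nonZeroDivisors (entireFunctions K)) (S := MeromorphicFunctions K)
    (T := nonZeroDivisors (entireFunctions E)) (Q := MeromorphicFunctions E)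
    (nonZeroDivisors_le_comap_nonZeroDivisors_of_injective _ (pullbackEntire_injective K)) p

/-- `F` is a quotient `p / q` of entire functions with `q φ = p` on `Z`. -/
def Represents (F : MeromorphicFunctions E) (Z : Set (E →L[ℝ] ℂ)) (φ : (E →L[ℝ] ℂ) → ℂ) : Prop :=
  ∃ p q : entireFunctions E, q ≠ 0 ∧ F * ofEntire q = ofEntire p ∧ ∀ z ∈ Z, q.1 z * φ z = p.1 z

namespace Represents

variable {F G : MeromorphicFunctions E} {Z Z' : Set (E →L[ℝ] ℂ)} {φ ψ : (E →L[ℝ] ℂ) → ℂ}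

theorem mono (h : Represents F Z φ) (hZ : Z' ⊆ Z) (hφ : ∀ z ∈ Z', ψ z = φ z) :
    Represents F Z' ψ := by
  obtain ⟨p, q, hq, hF, hpq⟩ := h
  exact ⟨p, q, hq, hF, fun z hz => by rw [hφ z hz]; exact hpq z (hZ hz)⟩

theorem of_entire (p : entireFunctions E) : Represents (ofEntire p) Z p.1 :=
  ⟨p, 1, one_ne_zero, by simp [ofEntire], fun z _ => one_mul _⟩

theorem add (hF : Represents F Z φ) (hG : Represents G Z ψ) :
    Represents (F + G) Z (fun z => φ z + ψ z) := by
  obtain ⟨p, q, hq, h1, h2⟩ := hF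
  obtain ⟨p', q', hq', h1', h2'⟩ := hG
  refine ⟨p * q' + p' * q, q * q', mul_ne_zero hq hq', ?_, fun z hz => ?_⟩
  · simp only [ofEntire, map_add, map_mul] at h1 h1' ⊢
    rw [← h1, ← h1']; ring
  · change q.1 z * q'.1 z * (φ z + ψ z) = p.1 z * q'.1 z + p'.1 z * q.1 z
    rw [← h2 z hz, ← h2' z hz]; ring

theorem mul (hF : Represents F Z φ) (hG : Represents G Z ψ) :
    Represents (F * G) Z (fun z => φ z * ψ z) := by
  obtain ⟨p, q, hq, h1, h2⟩ := hF
  obtain ⟨p', q', hq', h1', h2'⟩ := hG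
  refine ⟨p * p', q * q', mul_ne_zero hq hq', ?_, fun z hz => ?_⟩
  · simp only [ofEntire, map_mul] at h1 h1' ⊢
    rw [← h1, ← h1']; ring
  · change q.1 z * q'.1 z * (φ z * ψ z) = p.1 z * p'.1 z
    rw [← h2 z hz, ← h2' z hz]; ring

theorem zero : Represents (0 : MeromorphicFunctions E) Z (fun _ => 0) :=
  ⟨0, 1, one_ne_zero, by simp [ofEntire], fun z _ => mul_zero _⟩

theorem sum {ι : Type*} (s : Finset ι) {F : ι → MeromorphicFunctions E}
    {φ : ι → (E →L[ℝ] ℂ) → ℂ} (h : ∀ i ∈ s, Represents (F i) Z (φ i)) :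
    Represents (∑ i ∈ s, F i) Z (fun z => ∑ i ∈ s, φ i z) := by
  classical
  induction s using Finset.induction_on with
  | empty => simpa using zero
  | insert a s ha ih =>
    simp only [Finset.sum_insert ha]
    exact (h a (Finset.mem_insert_self _ _)).add
      (ih fun i hi => h i (Finset.mem_insert_of_mem hi))

/-- The factor `linForm v` is moved into the denominator, so frequencies with `z v = 0` need not be
removed from `Z`. -/
theorem inv_linForm_mul {v : E} (hv : v ≠ 0) (hF : Represents F Z (fun z => z v * φ z)) :
    Represents ((ofEntire (linForm v))⁻¹ * F) Z φ := by
  obtain ⟨p, q, hq, h1, h2⟩ := hF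
  have hv' : ofEntire (linForm v) ≠ 0 := fun h =>
    linForm_ne_zero hv (ofEntire_injective (by rw [h]; exact (map_zero _).symm))
  refine ⟨p, linForm v * q, mul_ne_zero (linForm_ne_zero hv) hq, ?_, fun z hz => ?_⟩
  · simp only [ofEntire, map_mul] at h1 ⊢
    rw [← h1]
    have hv2 : algebraMap (entireFunctions E) (MeromorphicFunctions E) (linForm v) ≠ 0 := hv'
    generalize algebraMap (entireFunctions E) (MeromorphicFunctions E) (linForm v) = a at *
    rw [show a⁻¹ * F * (a * algebraMap (entireFunctions E) (MeromorphicFunctions E) q) =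
      (a⁻¹ * a) * (F * algebraMap (entireFunctions E) (MeromorphicFunctions E) q) by ring,
      inv_mul_cancel₀ hv2, one_mul]
  · change z v * q.1 z * φ z = p.1 z
    rw [← h2 z hz]; ring

theorem pullback [FiniteDimensional ℝ E] {K : Submodule ℝ E} {F : MeromorphicFunctions K}
    {Z : Set (K →L[ℝ] ℂ)} {φ : (K →L[ℝ] ℂ) → ℂ} (hF : Represents F Z φ) :
    Represents (PolyhedraAlgebra.pullback K F) (restrictFreq K ⁻¹' Z)
      (fun z => φ (restrictFreq K z)) := by
  obtain ⟨p, q, hq, h1, h2⟩ := hF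
  refine ⟨pullbackEntire K p, pullbackEntire K q, ?_, ?_, fun z hz => h2 _ hz⟩
  · exact fun h => hq (pullbackEntire_injective K (by rw [h, map_zero]))
  · rw [← pullback_ofEntire, ← map_mul, h1, pullback_ofEntire]

/-- The cross products of numerators and denominators agree on an open set, hence everywhere. -/
theorem unique (hF : Represents F Z φ) (hG : Represents G Z φ) {O : Set (E →L[ℝ] ℂ)}
    (hO : IsOpen O) (hne : O.Nonempty) (hOZ : O ⊆ Z) : F = G := by
  obtain ⟨p, q, hq, h1, h2⟩ := hF
  obtain ⟨p', q', hq', h1', h2'⟩ := hG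
  have key : p * q' = p' * q := entire_eq_of_eqOn_open hO hne fun z hz => by
    change p.1 z * q'.1 z = p'.1 z * q.1 z
    rw [← h2 z (hOZ hz), ← h2' z (hOZ hz)]; ring
  have h3 : ofEntire (q * q') ≠ 0 := fun h =>
    mul_ne_zero hq hq' (ofEntire_injective (by rw [h]; exact (map_zero _).symm))
  refine mul_right_cancel₀ h3 ?_
  calc F * ofEntire (q * q') = (F * ofEntire q) * ofEntire q' := by
        simp only [ofEntire, map_mul]; ring
    _ = ofEntire (p * q') := by rw [h1]; simp only [ofEntire, map_mul]
    _ = (G * ofEntire q') * ofEntire q := by rw [key, h1']; simp only [ofEntire, map_mul]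
    _ = G * ofEntire (q * q') := by simp only [ofEntire, map_mul]; ring

end Represents

/-- Frequencies whose real part does not vanish on the vectors of `U`. -/
def genericFreq (U : Finset E) : Set (E →L[ℝ] ℂ) := {z | ∀ u ∈ U, (z u).re ≠ 0}

/-- The purely imaginary frequency `i ν`. -/
noncomputable def imagFreq (ν : E →L[ℝ] ℝ) : E →L[ℝ] ℂ := Complex.I • Complex.ofRealCLM.comp ν

@[simp] theorem imagFreq_apply (ν : E →L[ℝ] ℝ) (x : E) : imagFreq ν x = Complex.I * (ν x : ℂ) := rfl

theorem add_imagFreq_mem {U : Finset E} {z : E →L[ℝ] ℂ} (hz : z ∈ genericFreq U)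
    (ν : E →L[ℝ] ℝ) : z + imagFreq ν ∈ genericFreq U := fun u hu => by
  simpa using hz u hu

theorem isOpen_genericFreq (U : Finset E) : IsOpen (genericFreq U) := by
  have : genericFreq U = ⋂ u ∈ U, {z : E →L[ℝ] ℂ | (z u).re ≠ 0} := by
    ext z; simp [genericFreq]
  rw [this]
  refine isOpen_biInter_finset fun u _ => isOpen_ne_fun ?_ continuous_const
  exact Complex.continuous_re.comp (continuous_entire (linForm u))

/-- A real vector space is not a finite union of proper subspaces. -/
theorem exists_inner_ne_zero (U : Finset E) (hU : (0 : E) ∉ U) : ∃ v : E, ∀ u ∈ U, ⟪u, v⟫ ≠ 0 := by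
  obtain ⟨v, -, hv⟩ := Module.Dual.exists_forall_mem_ne_zero_of_forall_exists
    (ι := U) (K := ℝ) (M := E) ⊤ (fun u => (innerSL ℝ (u : E)).toLinearMap) (fun u =>
      ⟨u, trivial, fun h => hU (by
        have : (u : E) = 0 := inner_self_eq_zero.1 h
        rw [← this]; exact u.2)⟩)
  exact ⟨v, fun u hu => hv ⟨u, hu⟩⟩

theorem genericFreq_nonempty {U : Finset E} (hU : (0 : E) ∉ U) : (genericFreq U).Nonempty := by
  obtain ⟨v, hv⟩ := exists_inner_ne_zero U hU
  refine ⟨Complex.ofRealCLM.comp (innerSL ℝ v), fun u hu => ?_⟩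
  have := hv u hu
  rw [real_inner_comm] at this
  simpa using this

/-- `F` is a quotient of entire functions whose denominator does not vanish at the frequencies
generic for `U`, its values there are given by `φ`, and they are bounded on every set of
frequencies with a given real part. -/
def BoundedRep (U : Finset E) (F : MeromorphicFunctions E) (φ : (E →L[ℝ] ℂ) → ℂ) : Prop :=
  (∃ p q : entireFunctions E, F * ofEntire q = ofEntire p ∧
    ∀ z ∈ genericFreq U, q.1 z ≠ 0 ∧ q.1 z * φ z = p.1 z) ∧
  ∀ z ∈ genericFreq U, ∃ C, ∀ ν : E →L[ℝ] ℝ, ‖φ (z + imagFreq ν)‖ ≤ C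

namespace BoundedRep

variable {F G : MeromorphicFunctions E} {U U' : Finset E} {φ ψ : (E →L[ℝ] ℂ) → ℂ}

theorem mono (h : BoundedRep U F φ) (hU : U ⊆ U') : BoundedRep U' F φ := by
  obtain ⟨⟨p, q, h1, h2⟩, h3⟩ := h
  have hs : genericFreq U' ⊆ genericFreq U := fun z hz u hu => hz u (hU hu)
  exact ⟨⟨p, q, h1, fun z hz => h2 z (hs hz)⟩, fun z hz => h3 z (hs hz)⟩

theorem add (hF : BoundedRep U F φ) (hG : BoundedRep U G ψ) :
    BoundedRep U (F + G) (fun z => φ z + ψ z) := by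
  obtain ⟨⟨p, q, h1, h2⟩, h3⟩ := hF
  obtain ⟨⟨p', q', h1', h2'⟩, h3'⟩ := hG
  refine ⟨⟨p * q' + p' * q, q * q', ?_, fun z hz => ⟨?_, ?_⟩⟩, fun z hz => ?_⟩
  · simp only [ofEntire, map_add, map_mul] at h1 h1' ⊢
    rw [← h1, ← h1']; ring
  · exact mul_ne_zero (h2 z hz).1 (h2' z hz).1
  · change q.1 z * q'.1 z * (φ z + ψ z) = p.1 z * q'.1 z + p'.1 z * q.1 z
    rw [← (h2 z hz).2, ← (h2' z hz).2]; ring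
  · obtain ⟨C, hC⟩ := h3 z hz
    obtain ⟨C', hC'⟩ := h3' z hz
    refine ⟨C + C', fun ν => ?_⟩
    exact (norm_add_le (φ (z + imagFreq ν)) (ψ (z + imagFreq ν))).trans
      (add_le_add (hC ν) (hC' ν))

theorem mul (hF : BoundedRep U F φ) (hG : BoundedRep U G ψ) :
    BoundedRep U (F * G) (fun z => φ z * ψ z) := by
  obtain ⟨⟨p, q, h1, h2⟩, h3⟩ := hF
  obtain ⟨⟨p', q', h1', h2'⟩, h3'⟩ := hG
  refine ⟨⟨p * p', q * q', ?_, fun z hz => ⟨?_, ?_⟩⟩, fun z hz => ?_⟩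
  · simp only [ofEntire, map_mul] at h1 h1' ⊢
    rw [← h1, ← h1']; ring
  · exact mul_ne_zero (h2 z hz).1 (h2' z hz).1
  · change q.1 z * q'.1 z * (φ z * ψ z) = p.1 z * p'.1 z
    rw [← (h2 z hz).2, ← (h2' z hz).2]; ring
  · obtain ⟨C, hC⟩ := h3 z hz
    obtain ⟨C', hC'⟩ := h3' z hz
    refine ⟨C * C', fun ν => ?_⟩
    rw [norm_mul]
    exact mul_le_mul (hC ν) (hC' ν) (norm_nonneg _) ((norm_nonneg _).trans (hC ν))

theorem const (c : ℂ) : BoundedRep U (ofEntire (algebraMap ℂ (entireFunctions E) c))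
    (fun _ => c) :=
  ⟨⟨algebraMap ℂ _ c, 1, by simp [ofEntire], fun _ _ => ⟨one_ne_zero, one_mul c⟩⟩,
    fun _ _ => ⟨‖c‖, fun _ => le_rfl⟩⟩

theorem zero : BoundedRep U (0 : MeromorphicFunctions E) (fun _ => 0) := by
  simpa [ofEntire] using const (E := E) (U := U) 0

theorem expForm (x : E) : BoundedRep U (ofEntire (expForm x)) (fun z => Complex.exp (z x)) := by
  refine ⟨⟨PolyhedraAlgebra.expForm x, 1, by simp [ofEntire],
    fun z _ => ⟨one_ne_zero, one_mul _⟩⟩,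
    fun z _ => ⟨Real.exp (z x).re, fun ν => ?_⟩⟩
  rw [Complex.norm_exp]
  simp

/-- An imaginary shift preserves the real part of `z v`, whose absolute value bounds the modulus
from below. -/
theorem inv_linForm {v : E} (hv : v ≠ 0) :
    BoundedRep {v} (ofEntire (linForm v))⁻¹ (fun z => (z v)⁻¹) := by
  have hv' : ofEntire (linForm v) ≠ 0 := fun h =>
    linForm_ne_zero hv (ofEntire_injective (by rw [h]; exact (map_zero _).symm))
  have hne : ∀ z ∈ genericFreq {v}, z v ≠ 0 := fun z hz h => by
    refine hz v (Finset.mem_singleton_self v) ?_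
    rw [h]; rfl
  refine ⟨⟨1, linForm v, ?_, fun z hz => ⟨hne z hz, mul_inv_cancel₀ (hne z hz)⟩⟩,
    fun z hz => ⟨|(z v).re|⁻¹, fun ν => ?_⟩⟩
  · rw [inv_mul_cancel₀ hv']; exact (map_one _).symm
  · rw [norm_inv]
    refine inv_anti₀ (abs_pos.2 (hz v (Finset.mem_singleton_self v))) ?_
    have := Complex.abs_re_le_norm ((z + imagFreq ν) v)
    simpa using this

theorem sum {ι : Type*} (s : Finset ι) {F : ι → MeromorphicFunctions E}
    {φ : ι → (E →L[ℝ] ℂ) → ℂ} (h : ∀ i ∈ s, BoundedRep U (F i) (φ i)) :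
    BoundedRep U (∑ i ∈ s, F i) (fun z => ∑ i ∈ s, φ i z) := by
  classical
  induction s using Finset.induction_on with
  | empty => simpa using zero
  | insert a s ha ih =>
    simp only [Finset.sum_insert ha]
    exact (h a (Finset.mem_insert_self _ _)).add
      (ih fun i hi => h i (Finset.mem_insert_of_mem hi))

theorem pullback [FiniteDimensional ℝ E] {K : Submodule ℝ E} {F : MeromorphicFunctions K}
    {U : Finset K} {φ : (K →L[ℝ] ℂ) → ℂ} (hF : BoundedRep U F φ) :
    BoundedRep (U.map (Function.Embedding.subtype _)) (PolyhedraAlgebra.pullback K F)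
      (fun z => φ (restrictFreq K z)) := by
  obtain ⟨⟨p, q, h1, h2⟩, h3⟩ := hF
  have hr : ∀ z ∈ genericFreq (U.map (Function.Embedding.subtype (· ∈ K))),
      restrictFreq K z ∈ genericFreq U :=
    fun z hz u hu => hz u (Finset.mem_map.2 ⟨u, hu, rfl⟩)
  refine ⟨⟨pullbackEntire K p, pullbackEntire K q, ?_, fun z hz => h2 _ (hr z hz)⟩,
    fun z hz => ?_⟩
  · rw [← pullback_ofEntire, ← map_mul, h1, pullback_ofEntire]
  · obtain ⟨C, hC⟩ := h3 _ (hr z hz)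
    exact ⟨C, fun ν => hC (ν.comp K.subtypeL)⟩

/-- This and `zero_of_eq_zero` pass between identities of meromorphic functions and identities of
values. Here it matters that the denominator has no zero at a generic frequency. -/
theorem eq_zero_of_zero (h : BoundedRep U (0 : MeromorphicFunctions E) φ) :
    ∀ z ∈ genericFreq U, φ z = 0 := by
  obtain ⟨⟨p, q, h1, h2⟩, -⟩ := h
  have hp : p = 0 := ofEntire_injective (by rw [← h1, zero_mul]; exact (map_zero _).symm)
  intro z hz
  have h3 := (h2 z hz).2
  rw [hp] at h3
  exact (mul_eq_zero.1 h3).resolve_left (h2 z hz).1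

theorem zero_of_eq_zero (h : BoundedRep U F φ) (hU : (0 : E) ∉ U)
    (hφ : ∀ z ∈ genericFreq U, φ z = 0) : F = 0 := by
  obtain ⟨⟨p, q, h1, h2⟩, -⟩ := h
  have hp : p = 0 := entire_eq_of_eqOn_open (isOpen_genericFreq U) (genericFreq_nonempty hU)
    fun z hz => by rw [← (h2 z hz).2, hφ z hz, mul_zero]; rfl
  obtain ⟨z, hz⟩ := genericFreq_nonempty hU
  have hq : ofEntire q ≠ 0 := fun h => by
    have : q = 0 := ofEntire_injective (by rw [h]; exact (map_zero _).symm)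
    exact (h2 z hz).1 (by rw [this]; rfl)
  refine (mul_eq_zero.1 (h1.trans ?_)).resolve_right hq
  rw [hp]; exact map_zero _

end BoundedRep

/-- `F` is bounded on every generic set of frequencies with a given real part. -/
def IsBoundedOnFibers (F : MeromorphicFunctions E) : Prop :=
  ∃ U : Finset E, (0 : E) ∉ U ∧ ∃ φ, BoundedRep U F φ

namespace IsBoundedOnFibers

variable {F G : MeromorphicFunctions E}

theorem add (hF : IsBoundedOnFibers F) (hG : IsBoundedOnFibers G) : IsBoundedOnFibers (F + G) := by
  classical
  obtain ⟨U, hU, φ, h⟩ := hF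
  obtain ⟨U', hU', φ', h'⟩ := hG
  exact ⟨U ∪ U', by simp [hU, hU'], _,
    (h.mono Finset.subset_union_left).add (h'.mono Finset.subset_union_right)⟩

theorem mul (hF : IsBoundedOnFibers F) (hG : IsBoundedOnFibers G) : IsBoundedOnFibers (F * G) := by
  classical
  obtain ⟨U, hU, φ, h⟩ := hF
  obtain ⟨U', hU', φ', h'⟩ := hG
  exact ⟨U ∪ U', by simp [hU, hU'], _,
    (h.mono Finset.subset_union_left).mul (h'.mono Finset.subset_union_right)⟩

theorem const (c : ℂ) : IsBoundedOnFibers (ofEntire (algebraMap ℂ (entireFunctions E) c)) :=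
  ⟨∅, by simp, _, BoundedRep.const c⟩

theorem zero : IsBoundedOnFibers (0 : MeromorphicFunctions E) := ⟨∅, by simp, _, BoundedRep.zero⟩

theorem real_smul (c : ℝ) (hF : IsBoundedOnFibers F) : IsBoundedOnFibers (c • F) := by
  rw [real_smul_eq_ofEntire_mul]
  exact (const (c : ℂ)).mul hF

theorem sum {ι : Type*} (s : Finset ι) {F : ι → MeromorphicFunctions E}
    (h : ∀ i ∈ s, IsBoundedOnFibers (F i)) : IsBoundedOnFibers (∑ i ∈ s, F i) :=
  Finset.sum_induction _ _ (fun _ _ => add) zero h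

theorem expForm (x : E) : IsBoundedOnFibers (ofEntire (expForm x)) :=
  ⟨∅, by simp, _, BoundedRep.expForm x⟩

theorem inv_linForm {v : E} (hv : v ≠ 0) : IsBoundedOnFibers (ofEntire (linForm v))⁻¹ :=
  ⟨{v}, by simpa using hv.symm, _, BoundedRep.inv_linForm hv⟩

theorem pullback [FiniteDimensional ℝ E] {K : Submodule ℝ E} {F : MeromorphicFunctions K}
    (hF : IsBoundedOnFibers F) : IsBoundedOnFibers (PolyhedraAlgebra.pullback K F) := by
  obtain ⟨U, hU, φ, h⟩ := hF
  exact ⟨_, by simpa using hU, _, h.pullback⟩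

end IsBoundedOnFibers

end Meromorphic

/-! ### One-sided values of polyhedral functions along a hyperplane, and the signed section. -/

section Sections

variable {E : Type*} [NormedAddCommGroup E] [InnerProductSpace ℝ E]

namespace OrientedHyperplane

variable (h : OrientedHyperplane E)

theorem inner_normal_self : ⟪h.normal, h.normal⟫ = 1 := by
  rw [real_inner_self_eq_norm_sq, h.norm_normal, one_pow]

theorem normal_ne_zero : h.normal ≠ 0 := fun h0 => by
  have := h.norm_normal
  rw [h0, norm_zero] at this
  exact zero_ne_one this

theorem inner_normal_coe (y : h.Space) : ⟪h.normal, (y : E)⟫ = 0 :=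
  Submodule.mem_orthogonal_singleton_iff_inner_right.1 y.2

theorem inner_normal_param (y : h.Space) : ⟪h.normal, h.param y⟫ = h.offset := by
  rw [param, inner_add_right, inner_smul_right, h.inner_normal_self, h.inner_normal_coe]
  ring

theorem continuous_param : Continuous h.param :=
  continuous_const.add continuous_subtype_val

theorem exists_space_inner_ne_zero {a : E} (ha : ∀ μ : ℝ, a ≠ μ • h.normal) :
    ∃ y : h.Space, ⟪a, (y : E)⟫ ≠ 0 := by
  by_contra! hcon
  have h1 : a ∈ h.Spaceᗮ := (Submodule.mem_orthogonal' _ _).2 fun u hu => hcon ⟨u, hu⟩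
  rw [Space, Submodule.orthogonal_orthogonal] at h1
  obtain ⟨μ, hμ⟩ := Submodule.mem_span_singleton.1 h1
  exact ha μ hμ.symm

theorem isPolyhedron_preimage_param {P : Set E} (hP : IsPolyhedron P) :
    IsPolyhedron (h.param ⁻¹' P) := by
  classical
  obtain ⟨s, rfl⟩ := hP
  refine ⟨s.image fun ab =>
    (h.Space.orthogonalProjectionOnto ab.1, ab.2 - ⟪ab.1, h.offset • h.normal⟫), ?_⟩
  ext y
  simp only [Set.mem_preimage, Set.mem_ofPred_eq, Finset.forall_mem_image]
  refine forall₂_congr fun ab _ => ?_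
  rw [Submodule.inner_orthogonalProjectionOnto_eq_of_mem_right, param, inner_add_right]
  constructor <;> intro h <;> linarith

end OrientedHyperplane

/-- Near the point of `h` with parameter `y`, the function `f` is equal to `a` on the positive side
of `h` and to `b` on the negative side. -/
def HasSideValues (f : E → ℝ) (h : OrientedHyperplane E) (y : h.Space) (a b : ℝ) : Prop :=
  ∀ᶠ x in 𝓝 (h.param y), (h.offset < ⟪h.normal, x⟫ → f x = a) ∧ (⟪h.normal, x⟫ < h.offset → f x = b)

namespace HasSideValues

variable {f g : E → ℝ} {h : OrientedHyperplane E} {y : h.Space} {a b a' b' : ℝ}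

theorem add (hf : HasSideValues f h y a b) (hg : HasSideValues g h y a' b') :
    HasSideValues (f + g) h y (a + a') (b + b') := by
  filter_upwards [hf, hg] with x h1 h2
  exact ⟨fun h => by rw [Pi.add_apply, h1.1 h, h2.1 h], fun h => by rw [Pi.add_apply, h1.2 h, h2.2 h]⟩

theorem mul (hf : HasSideValues f h y a b) (hg : HasSideValues g h y a' b') :
    HasSideValues (f * g) h y (a * a') (b * b') := by
  filter_upwards [hf, hg] with x h1 h2
  exact ⟨fun h => by rw [Pi.mul_apply, h1.1 h, h2.1 h], fun h => by rw [Pi.mul_apply, h1.2 h, h2.2 h]⟩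

theorem smul (c : ℝ) (hf : HasSideValues f h y a b) :
    HasSideValues (c • f) h y (c * a) (c * b) := by
  filter_upwards [hf] with x h1
  exact ⟨fun h => by rw [Pi.smul_apply, h1.1 h, smul_eq_mul],
    fun h => by rw [Pi.smul_apply, h1.2 h, smul_eq_mul]⟩

theorem const (c : ℝ) : HasSideValues (fun _ => c) h y c c :=
  Eventually.of_forall fun _ => ⟨fun _ => rfl, fun _ => rfl⟩

theorem tendsto_param_add (h : OrientedHyperplane E) (y : h.Space) (w : E) :
    Tendsto (fun ε : ℝ => h.param y + ε • w) (𝓝[>] 0) (𝓝 (h.param y)) := by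
  have : Continuous fun ε : ℝ => h.param y + ε • w := by fun_prop
  simpa using (this.tendsto 0).mono_left nhdsWithin_le_nhds

theorem eventually_pos (hf : HasSideValues f h y a b) {w : E} (hw : 0 < ⟪h.normal, w⟫) :
    ∀ᶠ ε : ℝ in 𝓝[>] 0, f (h.param y + ε • w) = a := by
  filter_upwards [(tendsto_param_add h y w).eventually hf, self_mem_nhdsWithin] with ε h1 h2
  refine h1.1 ?_
  rw [inner_add_right, h.inner_normal_param, inner_smul_right]
  have := mul_pos (Set.mem_Ioi.1 h2) hw
  linarith

theorem eventually_neg (hf : HasSideValues f h y a b) {w : E} (hw : ⟪h.normal, w⟫ < 0) :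
    ∀ᶠ ε : ℝ in 𝓝[>] 0, f (h.param y + ε • w) = b := by
  filter_upwards [(tendsto_param_add h y w).eventually hf, self_mem_nhdsWithin] with ε h1 h2
  refine h1.2 ?_
  rw [inner_add_right, h.inner_normal_param, inner_smul_right]
  have := mul_pos_of_neg_of_neg (neg_lt_zero.2 (Set.mem_Ioi.1 h2)) hw
  linarith

theorem signedSection_eq (hf : HasSideValues f h y a b) : signedSection f h y = a - b := by
  have h1 : ∀ᶠ ε : ℝ in 𝓝[>] 0, f (h.param y + ε • h.normal) = a :=
    hf.eventually_pos (by rw [h.inner_normal_self]; exact one_pos)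
  have h2 : ∀ᶠ ε : ℝ in 𝓝[>] 0, f (h.param y - ε • h.normal) = b := by
    have := hf.eventually_neg (w := -h.normal)
      (by rw [inner_neg_right, h.inner_normal_self]; exact neg_lt_zero.2 one_pos)
    simpa only [smul_neg, ← sub_eq_add_neg] using this
  rw [signedSection, Tendsto.limUnder_eq (tendsto_const_nhds.congr' (EventuallyEq.symm h1)),
    Tendsto.limUnder_eq (tendsto_const_nhds.congr' (EventuallyEq.symm h2))]

end HasSideValues

theorem isClosed_polyhedron {P : Set E} (hP : IsPolyhedron P) : IsClosed P := by
  obtain ⟨s, rfl⟩ := hP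
  simp only [Set.ofPred_forall]
  exact isClosed_biInter fun ab _ => isClosed_le (by fun_prop) continuous_const

theorem convex_polyhedron {P : Set E} (hP : IsPolyhedron P) : Convex ℝ P := by
  obtain ⟨s, rfl⟩ := hP
  simp only [Set.ofPred_forall]
  exact convex_iInter₂ fun ab _ => convex_halfSpace_le (innerSL ℝ ab.1).isLinear ab.2

theorem indicatorFn_mem {P : Set E} (hP : IsPolyhedron P) : indicatorFn P ∈ polyhedralFunctions E :=
  Submodule.subset_span ⟨P, hP, rfl⟩

theorem measurable_polyhedral [MeasurableSpace E] [BorelSpace E] {f : E → ℝ}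
    (hf : f ∈ polyhedralFunctions E) : Measurable f := by
  induction hf using Submodule.span_induction with
  | mem g hg =>
    obtain ⟨P, hP, rfl⟩ := hg
    exact measurable_const.indicator (isClosed_polyhedron hP).measurableSet
  | zero => exact measurable_zero
  | add f g _ _ ihf ihg => exact ihf.add ihg
  | smul c f _ ih => exact ih.const_smul c

theorem ae_inner_ne {F : Type*} [NormedAddCommGroup F] [InnerProductSpace ℝ F]
    [FiniteDimensional ℝ F] [MeasurableSpace F] [BorelSpace F] (ℓ : F →L[ℝ] ℝ) (hℓ : ℓ ≠ 0) (b : ℝ) :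
    ∀ᵐ y : F, ℓ y ≠ b := by
  let A : AffineSubspace ℝ F :=
    { carrier := {y | ℓ y = b}
      smul_vsub_vadd_mem' := fun c p q r hp hq hr => by
        simp only [Set.mem_ofPred_eq, vsub_eq_sub, vadd_eq_add, map_add, map_smul, map_sub] at *
        rw [hp, hq, hr]; simp }
  have hA : A ≠ ⊤ := by
    intro hA
    have hall : ∀ y, ℓ y = b := fun y => by
      have : y ∈ A := hA ▸ AffineSubspace.mem_top ℝ F y
      exact this
    refine hℓ (ContinuousLinearMap.ext fun y => ?_)
    rw [hall y, ← hall 0, map_zero]; rfl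
  have := Measure.addHaar_affineSubspace volume A hA
  rw [ae_iff]
  exact measure_mono_null (fun y hy => not_not.1 hy) this

variable [FiniteDimensional ℝ E] [MeasurableSpace E] [BorelSpace E]

theorem ae_inner_param_ne (h : OrientedHyperplane E) {a : E} (ha : ∀ μ : ℝ, a ≠ μ • h.normal)
    (b : ℝ) : ∀ᵐ y : h.Space, ⟪a, h.param y⟫ ≠ b := by
  obtain ⟨y₀, hy₀⟩ := h.exists_space_inner_ne_zero ha
  have := ae_inner_ne ((innerSL ℝ a).comp h.Space.subtypeL)
    (fun h0 => hy₀ (by simpa using congrArg (fun ℓ => ℓ y₀) h0)) (b - h.offset * ⟪a, h.normal⟫)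
  filter_upwards [this] with y hy hcon
  refine hy ?_
  rw [OrientedHyperplane.param, inner_add_right, inner_smul_right] at hcon
  simp only [ContinuousLinearMap.comp_apply, Submodule.subtypeL_apply, innerSL_apply_apply]
  linarith

-- Off its boundary the half-space has a locally constant indicator, and the boundary meets `h` in a
-- null set unless it contains `h`. The multipliers `κ`, `κ'` do not depend on `y`, so a section of
-- a polyhedron is a multiple of one indicator. The clause on `w` says that invariance in a
-- direction transverse to `h` excludes a jump; it serves for polyhedra that contain lines.
open scoped Classical in
theorem exists_sideValues_halfSpace (h : OrientedHyperplane E) (a : E) (b : ℝ) :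
    ∃ κ κ' : ℝ, (∀ w, ⟪a, w⟫ = 0 → ⟪h.normal, w⟫ ≠ 0 → κ = κ') ∧
      ∀ᵐ y : h.Space, HasSideValues (indicatorFn {x | ⟪a, x⟫ ≤ b}) h y
        (κ * indicatorFn {x | ⟪a, x⟫ ≤ b} (h.param y))
        (κ' * indicatorFn {x | ⟪a, x⟫ ≤ b} (h.param y)) := by
  have hcont : Continuous fun x : E => ⟪a, x⟫ := by fun_prop
  have hloc : ∀ y : h.Space, ⟪a, h.param y⟫ ≠ b →
      HasSideValues (indicatorFn {x | ⟪a, x⟫ ≤ b}) h y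
        (1 * indicatorFn {x | ⟪a, x⟫ ≤ b} (h.param y))
        (1 * indicatorFn {x | ⟪a, x⟫ ≤ b} (h.param y)) := by
    intro y hy
    have : ∀ᶠ x in 𝓝 (h.param y), indicatorFn {x | ⟪a, x⟫ ≤ b} x =
        1 * indicatorFn {x | ⟪a, x⟫ ≤ b} (h.param y) := by
      rcases lt_or_gt_of_ne hy with h1 | h1
      · filter_upwards [hcont.continuousAt.eventually_lt continuousAt_const h1] with x hx
        simp [indicatorFn, Set.indicator, hx.le, h1.le]
      · filter_upwards [continuousAt_const.eventually_lt hcont.continuousAt h1] with x hx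
        simp [indicatorFn, Set.indicator, not_le.2 hx, not_le.2 h1]
    filter_upwards [this] with x hx
    exact ⟨fun _ => hx, fun _ => hx⟩
  by_cases ha : ∃ μ : ℝ, a = μ • h.normal
  · obtain ⟨μ, rfl⟩ := ha
    have hpar : ∀ y, ⟪μ • h.normal, h.param y⟫ = μ * h.offset := fun y => by
      rw [real_inner_smul_left, h.inner_normal_param]
    by_cases hb : μ * h.offset = b
    -- Here the constraint is an equality on `h`. It holds on the positive side exactly when `μ ≤
    -- 0`, and on the negative side exactly when `0 ≤ μ`; both multipliers are 1 in the degenerate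
    -- case `μ = 0`.
    · refine ⟨if μ ≤ 0 then 1 else 0, if 0 ≤ μ then 1 else 0, fun w hw hw' => ?_,
        Eventually.of_forall fun y => Eventually.of_forall fun x => ⟨fun hx => ?_, fun hx => ?_⟩⟩
      · rw [real_inner_smul_left] at hw
        simp [(mul_eq_zero.1 hw).resolve_right hw']
      · have : μ * ⟪h.normal, x⟫ ≤ b ↔ μ ≤ 0 := by
          rw [← hb]
          constructor
          · intro h1; by_contra! h2; nlinarith
          · intro h1; nlinarith
        have hy : μ * ⟪h.normal, h.param y⟫ ≤ b := by rw [h.inner_normal_param, hb]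
        simp only [indicatorFn, Set.indicator, Set.mem_ofPred_eq, real_inner_smul_left, this, hy,
          if_true, mul_one]
      · have : μ * ⟪h.normal, x⟫ ≤ b ↔ 0 ≤ μ := by
          rw [← hb]
          constructor
          · intro h1; by_contra! h2; nlinarith
          · intro h1; nlinarith
        have hy : μ * ⟪h.normal, h.param y⟫ ≤ b := by rw [h.inner_normal_param, hb]
        simp only [indicatorFn, Set.indicator, Set.mem_ofPred_eq, real_inner_smul_left, this, hy,
          if_true, mul_one]
    · exact ⟨1, 1, fun _ _ _ => rfl, Eventually.of_forall fun y => hloc y (by rwa [hpar])⟩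
  · push Not at ha
    refine ⟨1, 1, fun _ _ _ => rfl, ?_⟩
    filter_upwards [ae_inner_param_ne h ha b] with y hy
    exact hloc y hy

/-- The indicator is a product of indicators of half-spaces, and the multipliers multiply. -/
theorem exists_sideValues_polyhedron (h : OrientedHyperplane E) (s : Finset (E × ℝ)) :
    ∃ κ κ' : ℝ, (∀ w, (∀ ab ∈ s, ⟪ab.1, w⟫ = 0) → ⟪h.normal, w⟫ ≠ 0 → κ = κ') ∧
      ∀ᵐ y : h.Space, HasSideValues (indicatorFn {x | ∀ ab ∈ s, ⟪ab.1, x⟫ ≤ ab.2}) h y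
        (κ * indicatorFn {x | ∀ ab ∈ s, ⟪ab.1, x⟫ ≤ ab.2} (h.param y))
        (κ' * indicatorFn {x | ∀ ab ∈ s, ⟪ab.1, x⟫ ≤ ab.2} (h.param y)) := by
  classical
  induction s using Finset.induction_on with
  | empty =>
    refine ⟨1, 1, fun _ _ _ => rfl, Eventually.of_forall fun y => ?_⟩
    simpa [indicatorFn] using HasSideValues.const 1
  | insert ab s _ ih =>
    obtain ⟨κ, κ', h1, h2⟩ := ih
    obtain ⟨τ, τ', h1', h2'⟩ := exists_sideValues_halfSpace h ab.1 ab.2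
    have hmul : indicatorFn {x : E | ∀ cd ∈ insert ab s, ⟪cd.1, x⟫ ≤ cd.2} =
        indicatorFn {x | ⟪ab.1, x⟫ ≤ ab.2} * indicatorFn {x | ∀ ab ∈ s, ⟪ab.1, x⟫ ≤ ab.2} := by
      ext x
      simp only [indicatorFn, Set.indicator, Set.mem_ofPred_eq, Finset.forall_mem_insert,
        Pi.mul_apply, mul_ite, ite_mul, one_mul, zero_mul, mul_zero]
      by_cases p : ⟪ab.1, x⟫ ≤ ab.2 <;> by_cases q : ∀ ab ∈ s, ⟪ab.1, x⟫ ≤ ab.2 <;> simp [p]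
    refine ⟨τ * κ, τ' * κ', fun w hw hw' => ?_, ?_⟩
    · rw [h1 w (fun cd hcd => hw cd (Finset.mem_insert_of_mem hcd)) hw',
        h1' w (hw ab (Finset.mem_insert_self _ _)) hw']
    · filter_upwards [h2, h2'] with y hy hy'
      rw [hmul, Pi.mul_apply]
      have := hy'.mul hy
      rwa [mul_mul_mul_comm, mul_mul_mul_comm τ'] at this

theorem ae_exists_sideValues {f : E → ℝ} (hf : f ∈ polyhedralFunctions E)
    (h : OrientedHyperplane E) : ∀ᵐ y : h.Space, ∃ a b, HasSideValues f h y a b := by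
  induction hf using Submodule.span_induction with
  | mem g hg =>
    obtain ⟨P, ⟨s, rfl⟩, rfl⟩ := hg
    obtain ⟨κ, κ', -, h2⟩ := exists_sideValues_polyhedron h s
    filter_upwards [h2] with y hy
    exact ⟨_, _, hy⟩
  | zero => exact Eventually.of_forall fun y => ⟨0, 0, HasSideValues.const 0⟩
  | add f g _ _ ihf ihg =>
    filter_upwards [ihf, ihg] with y h1 h2
    obtain ⟨a, b, h1⟩ := h1
    obtain ⟨a', b', h2⟩ := h2
    exact ⟨_, _, h1.add h2⟩
  | smul c f _ ih =>
    filter_upwards [ih] with y h1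
    obtain ⟨a, b, h1⟩ := h1
    exact ⟨_, _, h1.smul c⟩

theorem signedSection_polyhedron (h : OrientedHyperplane E) (s : Finset (E × ℝ)) :
    ∃ κ : ℝ, (∀ w, (∀ ab ∈ s, ⟪ab.1, w⟫ = 0) → ⟪h.normal, w⟫ ≠ 0 → κ = 0) ∧
      signedSection (indicatorFn {x | ∀ ab ∈ s, ⟪ab.1, x⟫ ≤ ab.2}) h =ᵐ[volume]
        κ • indicatorFn (h.param ⁻¹' {x | ∀ ab ∈ s, ⟪ab.1, x⟫ ≤ ab.2}) := by
  obtain ⟨κ, κ', h1, h2⟩ := exists_sideValues_polyhedron h s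
  refine ⟨κ - κ', fun w hw hw' => sub_eq_zero.2 (h1 w hw hw'), ?_⟩
  filter_upwards [h2] with y hy
  rw [hy.signedSection_eq, ← sub_mul]
  rfl

theorem signedSection_add {f g : E → ℝ} (hf : f ∈ polyhedralFunctions E)
    (hg : g ∈ polyhedralFunctions E) (h : OrientedHyperplane E) :
    signedSection (f + g) h =ᵐ[volume] signedSection f h + signedSection g h := by
  filter_upwards [ae_exists_sideValues hf h, ae_exists_sideValues hg h] with y h1 h2
  obtain ⟨a, b, h1⟩ := h1
  obtain ⟨a', b', h2⟩ := h2
  rw [(h1.add h2).signedSection_eq, Pi.add_apply, h1.signedSection_eq, h2.signedSection_eq]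
  ring

theorem signedSection_smul {f : E → ℝ} (hf : f ∈ polyhedralFunctions E) (c : ℝ)
    (h : OrientedHyperplane E) : signedSection (c • f) h =ᵐ[volume] c • signedSection f h := by
  filter_upwards [ae_exists_sideValues hf h] with y h1
  obtain ⟨a, b, h1⟩ := h1
  rw [(h1.smul c).signedSection_eq, Pi.smul_apply, h1.signedSection_eq, smul_eq_mul]
  ring

/-- A side value is attained on a nonempty open set, which has positive measure. Thus sectioning
respects equality almost everywhere, although `h` itself is a null set. -/
theorem signedSection_ae_zero {f : E → ℝ} (hf : f ∈ polyhedralFunctions E)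
    (h0 : f =ᵐ[volume] fun _ => (0 : ℝ)) (h : OrientedHyperplane E) :
    signedSection f h =ᵐ[volume] fun _ => (0 : ℝ) := by
  have hcont : Continuous fun x : E => ⟪h.normal, x⟫ := by fun_prop
  have key : ∀ (y : h.Space) (S : Set E) (a : ℝ), IsOpen S →
      (∀ᶠ x in 𝓝 (h.param y), x ∈ S → f x = a) → (∃ᶠ x in 𝓝 (h.param y), x ∈ S) → a = 0 := by
    intro y S a hS h1 h2
    obtain ⟨O, hO, hO', hyO⟩ := eventually_nhds_iff.1 h1
    obtain ⟨x, hx, hx'⟩ := (h2.and_eventually (hO'.mem_nhds hyO)).exists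
    by_contra ha
    have hpos : 0 < volume (O ∩ S) := (hO'.inter hS).measure_pos _ ⟨x, hx', hx⟩
    refine hpos.ne' (measure_mono_null (fun u hu => ?_) (ae_iff.1 h0))
    change ¬ f u = 0
    rw [hO u hu.1 hu.2]
    exact ha
  filter_upwards [ae_exists_sideValues hf h] with y h1
  obtain ⟨a, b, h1⟩ := h1
  have hfreq : ∀ w : E, ∀ S : Set E, (∀ ε : ℝ, 0 < ε → h.param y + ε • w ∈ S) →
      ∃ᶠ x in 𝓝 (h.param y), x ∈ S := by
    intro w S hw
    refine (HasSideValues.tendsto_param_add h y w).frequently (Eventually.frequently ?_)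
    filter_upwards [self_mem_nhdsWithin] with ε hε using hw ε hε
  have ha : a = 0 := key y {x | h.offset < ⟪h.normal, x⟫} a (isOpen_lt continuous_const hcont)
    (h1.mono fun x hx => hx.1) (hfreq h.normal _ fun ε hε => by
      rw [Set.mem_ofPred_eq, inner_add_right, h.inner_normal_param, inner_smul_right,
        h.inner_normal_self]
      linarith)
  have hb : b = 0 := key y {x | ⟪h.normal, x⟫ < h.offset} b (isOpen_lt hcont continuous_const)
    (h1.mono fun x hx => hx.2) (hfreq (-h.normal) _ fun ε hε => by
      rw [Set.mem_ofPred_eq, inner_add_right, h.inner_normal_param, inner_smul_right,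
        inner_neg_right, h.inner_normal_self]
      linarith)
  rw [h1.signedSection_eq, ha, hb, sub_zero]

end Sections

/-! ### Integration by parts, as a limit of difference quotients. -/

section Stokes

theorem integrable_exp_neg_mul_norm {F : Type*} [NormedAddCommGroup F] [NormedSpace ℝ F]
    [FiniteDimensional ℝ F] [MeasurableSpace F] [BorelSpace F] (μ : Measure F) [μ.IsAddHaarMeasure]
    {δ : ℝ} (hδ : 0 < δ) : Integrable (fun x : F => Real.exp (-δ * ‖x‖)) μ := by
  set N := Module.finrank ℝ F + 1
  have h1 : Integrable (fun x : F => (1 + ‖x‖) ^ (-(N : ℝ))) μ :=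
    integrable_one_add_norm (by simp [N])
  -- The constant comes from `u ^ N / N! ≤ exp u` at `u = δ (1 + ‖x‖)`.
  refine (h1.const_mul (N.factorial * Real.exp δ / δ ^ N)).mono'
    (by fun_prop) (Eventually.of_forall fun x => ?_)
  have hx : 0 < 1 + ‖x‖ := by positivity
  have h2 := Real.pow_div_factorial_le_exp (δ * (1 + ‖x‖)) (by positivity) N
  rw [Real.norm_eq_abs, abs_of_pos (Real.exp_pos _), Real.rpow_neg hx.le, Real.rpow_natCast,
    neg_mul, Real.exp_neg, div_mul_eq_mul_div, ← div_eq_mul_inv, le_div_iff₀ (by positivity),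
    le_div_iff₀ (by positivity), inv_mul_eq_div, div_mul_eq_mul_div, div_le_iff₀ (Real.exp_pos _)]
  rw [div_le_iff₀ (by positivity), mul_pow, mul_add, mul_one, Real.exp_add] at h2
  linarith

variable {E : Type*} [NormedAddCommGroup E] [InnerProductSpace ℝ E]

theorem OrientedHyperplane.eq_of_normal_eq_smul {h h' : OrientedHyperplane E} {v : E} {μ : ℝ}
    (hv : 0 < ⟪h.normal, v⟫) (hv' : 0 < ⟪h'.normal, v⟫) (hμ : h'.normal = μ • h.normal) :
    h'.normal = h.normal := by
  have h1 : |μ| = 1 := by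
    have := h'.norm_normal
    rwa [hμ, norm_smul, h.norm_normal, mul_one] at this
  have h2 : 0 < μ := by
    rw [hμ, real_inner_smul_left] at hv'
    exact (pos_iff_pos_of_mul_pos hv').2 hv
  rw [abs_of_pos h2] at h1
  rw [hμ, h1, one_smul]

theorem OrientedHyperplane.ext_normal_offset {h h' : OrientedHyperplane E}
    (hn : h.normal = h'.normal) (ho : h.offset = h'.offset) : h = h' := by
  cases h; cases h'; simp_all

theorem OrientedHyperplane.norm_le_norm_param_sub (h : OrientedHyperplane E) (y : h.Space) (r : ℝ) :
    ‖y‖ ≤ ‖h.param y - r • h.normal‖ := by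
  have h1 : ⟪(y : E), h.param y - r • h.normal⟫ = ‖y‖ * ‖y‖ := by
    rw [param, inner_sub_right, inner_add_right, inner_smul_right, inner_smul_right,
      real_inner_comm, h.inner_normal_coe, real_inner_self_eq_norm_mul_norm, Submodule.coe_norm]
    ring
  have h2 := real_inner_le_norm (y : E) (h.param y - r • h.normal)
  rw [h1, Submodule.coe_norm] at h2
  rcases (norm_nonneg y).eq_or_lt with h3 | h3
  · rw [← h3]; exact norm_nonneg _
  · exact le_of_mul_le_mul_left h2 h3

open scoped Classical in
/-- The indicator function of the points `x` such that the segment from `x` to `x + ε v` meets `h`,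
for a vector `v` pointing to the positive side of `h`. -/
noncomputable def crossing (v : E) (ε : ℝ) (h : OrientedHyperplane E) (x : E) : ℝ :=
  if ⟪h.normal, x⟫ ≤ h.offset ∧ h.offset ≤ ⟪h.normal, x⟫ + ε * ⟪h.normal, v⟫ then 1 else 0

theorem crossing_nonneg (v : E) (ε : ℝ) (h : OrientedHyperplane E) (x : E) :
    0 ≤ crossing v ε h x := by
  unfold crossing; split_ifs <;> norm_num

/-- The share of `h` in the increment `f (x + ε v) - f x`. -/
noncomputable def jumpShare (f : E → ℝ) (H : Finset (OrientedHyperplane E)) (v : E) (ε : ℝ)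
    (h : OrientedHyperplane E) (x : E) : ℝ :=
  crossing v ε h x / (∑ h' ∈ H, crossing v ε h' x) * (f (x + ε • v) - f x)

/-- The hyperplanes of `H` separate the points where `f` changes in the direction `v`. -/
def CoversJumps (f : E → ℝ) (H : Finset (OrientedHyperplane E)) (v : E) : Prop :=
  ∀ x, ∀ ε : ℝ, 0 < ε → f (x + ε • v) ≠ f x → ∃ h ∈ H, crossing v ε h x = 1

/-- Where `f` changes, some hyperplane is crossed, so the weights add up to 1. Where it does not,
all shares are 0, even if the weights are quotients `0 / 0`. -/
theorem sum_jumpShare {f : E → ℝ} {H : Finset (OrientedHyperplane E)} {v : E}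
    (hf : CoversJumps f H v) {ε : ℝ} (hε : 0 < ε) (x : E) :
    ∑ h ∈ H, jumpShare f H v ε h x = f (x + ε • v) - f x := by
  simp only [jumpShare]
  rw [← Finset.sum_mul, ← Finset.sum_div]
  by_cases hx : f (x + ε • v) = f x
  · rw [hx, sub_self, mul_zero]
  · obtain ⟨h, hh, h1⟩ := hf x ε hε hx
    have : 0 < ∑ h' ∈ H, crossing v ε h' x :=
      Finset.sum_pos' (fun _ _ => crossing_nonneg _ _ _ _) ⟨h, hh, by rw [h1]; exact one_pos⟩
    rw [div_self this.ne', one_mul]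

theorem abs_jumpShare_le (f : E → ℝ) {H : Finset (OrientedHyperplane E)} (v : E) (ε : ℝ)
    {h : OrientedHyperplane E} (hh : h ∈ H) (x : E) :
    |jumpShare f H v ε h x| ≤ crossing v ε h x * (|f (x + ε • v)| + |f x|) := by
  rw [jumpShare, abs_mul]
  refine mul_le_mul ?_ (abs_sub _ _) (abs_nonneg _) (crossing_nonneg _ _ _ _)
  have hsum : crossing v ε h x ≤ ∑ h' ∈ H, crossing v ε h' x :=
    Finset.single_le_sum (f := fun h' => crossing v ε h' x)
      (fun _ _ => crossing_nonneg v ε _ x) hh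
  have h01 : crossing v ε h x = 0 ∨ crossing v ε h x = 1 := by
    unfold crossing; split_ifs <;> simp
  rcases h01 with h0 | h1
  · simp [h0]
  · rw [h1] at hsum ⊢
    rw [abs_of_nonneg (div_nonneg zero_le_one (by linarith)), div_le_one (by linarith)]
    exact hsum

/-- With the distance to `h` measured in units of `ε`, the slab of crossing points no longer depends
on `ε`. This permits dominated convergence on a fixed domain. -/
theorem crossing_param_sub {v : E} {ε : ℝ} (hε : 0 < ε) (h : OrientedHyperplane E) (s : ℝ)
    (y : h.Space) : crossing v ε h (h.param y - (ε * s) • h.normal) =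
      (Set.Icc 0 ⟪h.normal, v⟫).indicator (fun _ => (1 : ℝ)) s := by
  have h1 : ⟪h.normal, h.param y - (ε * s) • h.normal⟫ = h.offset - ε * s := by
    rw [inner_sub_right, h.inner_normal_param, inner_smul_right, h.inner_normal_self, mul_one]
  have h2 : (h.offset - ε * s ≤ h.offset ∧
      h.offset ≤ h.offset - ε * s + ε * ⟪h.normal, v⟫) ↔ s ∈ Set.Icc 0 ⟪h.normal, v⟫ := by
    rw [Set.mem_Icc]
    constructor
    · rintro ⟨h3, h4⟩
      exact ⟨by by_contra! h5; nlinarith, by by_contra! h5; nlinarith⟩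
    · rintro ⟨h3, h4⟩
      exact ⟨by nlinarith, by nlinarith⟩
  by_cases hs : s ∈ Set.Icc 0 ⟪h.normal, v⟫
  · rw [crossing, h1, if_pos (h2.2 hs), Set.indicator_of_mem hs]
  · rw [crossing, h1, if_neg (h2.not.2 hs), Set.indicator_of_notMem hs]

theorem measurable_crossing [MeasurableSpace E] [BorelSpace E] (v : E) (ε : ℝ) (h : OrientedHyperplane E) :
    Measurable (crossing v ε h) := by
  have hc : Continuous fun x : E => ⟪h.normal, x⟫ := by fun_prop
  exact Measurable.ite ((isClosed_le hc continuous_const).inter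
    (isClosed_le continuous_const (hc.add continuous_const))).measurableSet
    measurable_const measurable_const

theorem measurable_jumpShare [MeasurableSpace E] [BorelSpace E] {f : E → ℝ} (hf : Measurable f)
    (H : Finset (OrientedHyperplane E)) (v : E) (ε : ℝ) (h : OrientedHyperplane E) : Measurable (jumpShare f H v ε h) :=
  ((measurable_crossing v ε h).div
    (Finset.measurable_fun_sum _ fun h' _ => measurable_crossing v ε h')).mul
    ((hf.comp (measurable_id.add_const _)).sub hf)

/-- Near a point off the other hyperplanes only `h` is crossed once `ε` is small, so `h` receives
the whole increment. The condition `0 < s < ⟪n, v⟫` puts the two ends of the segment on opposite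
sides of `h`. -/
theorem eventually_jumpShare_eq {f : E → ℝ} {H : Finset (OrientedHyperplane E)} {v : E}
    {h : OrientedHyperplane E} (hh : h ∈ H) {y : h.Space}
    (hy : ∀ h' ∈ H, h' ≠ h → ⟪h'.normal, h.param y⟫ ≠ h'.offset) {a b : ℝ}
    (hab : HasSideValues f h y a b) {s : ℝ} (hs : 0 < s) (hs' : s < ⟪h.normal, v⟫) :
    ∀ᶠ ε : ℝ in 𝓝[>] 0, jumpShare f H v ε h (h.param y - (ε * s) • h.normal) = a - b := by
  have hrew : ∀ ε : ℝ, h.param y - (ε * s) • h.normal = h.param y + ε • (-(s • h.normal)) :=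
    fun ε => by rw [mul_smul, smul_neg, sub_eq_add_neg]
  have hrew' : ∀ ε : ℝ, h.param y - (ε * s) • h.normal + ε • v =
      h.param y + ε • (v - s • h.normal) := fun ε => by rw [mul_smul, smul_sub]; abel
  have h1 : ∀ᶠ ε : ℝ in 𝓝[>] 0, f (h.param y - (ε * s) • h.normal) = b := by
    simp only [hrew]
    refine hab.eventually_neg ?_
    rw [inner_neg_right, inner_smul_right, h.inner_normal_self]
    linarith
  have h2 : ∀ᶠ ε : ℝ in 𝓝[>] 0, f (h.param y - (ε * s) • h.normal + ε • v) = a := by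
    simp only [hrew']
    refine hab.eventually_pos ?_
    rw [inner_sub_right, inner_smul_right, h.inner_normal_self]
    linarith
  have h3 : ∀ᶠ ε : ℝ in 𝓝[>] 0, ∀ h' ∈ H, h' ≠ h →
      crossing v ε h' (h.param y - (ε * s) • h.normal) = 0 := by
    refine (Finset.eventually_all H).2 fun h' hh' => ?_
    by_cases hne : h' = h
    · exact Eventually.of_forall fun _ h0 => absurd hne h0
    have hc1 : Tendsto (fun ε : ℝ => ⟪h'.normal, h.param y - (ε * s) • h.normal⟫) (𝓝[>] 0)
        (𝓝 ⟪h'.normal, h.param y⟫) := by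
      have : Continuous fun ε : ℝ => ⟪h'.normal, h.param y - (ε * s) • h.normal⟫ := by fun_prop
      simpa using (this.tendsto 0).mono_left nhdsWithin_le_nhds
    have hc2 : Tendsto (fun ε : ℝ => ⟪h'.normal, h.param y - (ε * s) • h.normal⟫ +
        ε * ⟪h'.normal, v⟫) (𝓝[>] 0) (𝓝 ⟪h'.normal, h.param y⟫) := by
      have : Continuous fun ε : ℝ => ⟪h'.normal, h.param y - (ε * s) • h.normal⟫ +
        ε * ⟪h'.normal, v⟫ := by fun_prop
      simpa using (this.tendsto 0).mono_left nhdsWithin_le_nhds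
    rcases lt_or_gt_of_ne (hy h' hh' hne) with hlt | hlt
    · filter_upwards [hc2.eventually_lt_const hlt] with ε hε _
      exact if_neg fun hcon => by linarith [hcon.2]
    · filter_upwards [hc1.eventually_const_lt hlt] with ε hε _
      exact if_neg fun hcon => by linarith [hcon.1]
  filter_upwards [h1, h2, h3, self_mem_nhdsWithin] with ε e1 e2 e3 hε
  have hcr : crossing v ε h (h.param y - (ε * s) • h.normal) = 1 := by
    rw [crossing_param_sub hε]
    exact Set.indicator_of_mem (show s ∈ Set.Icc 0 ⟪h.normal, v⟫ from ⟨hs.le, hs'.le⟩) _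
  rw [jumpShare, e1, e2, Finset.sum_eq_single_of_mem h hh e3, hcr, div_one, one_mul]

variable [FiniteDimensional ℝ E] [MeasurableSpace E] [BorelSpace E]

namespace OrientedHyperplane

variable (h : OrientedHyperplane E)

theorem measurePreserving_smul_normal_add :
    MeasurePreserving (fun p : ℝ × h.Space => p.1 • h.normal + (p.2 : E)) := by
  have h1 := ((LinearIsometryEquiv.toSpanUnitSingleton (𝕜 := ℝ) h.normal
    h.norm_normal).measurePreserving).prod (MeasurePreserving.id (volume : Measure h.Space))
  have h2 := WithLp.volume_preserving_toLp (Submodule.span ℝ {h.normal}) h.Space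
  have h3 := (Submodule.orthogonalDecomposition (Submodule.span ℝ {h.normal})).symm.measurePreserving
  exact (h3.comp h2).comp h1

theorem measurableEmbedding_smul_normal_add :
    MeasurableEmbedding (fun p : ℝ × h.Space => p.1 • h.normal + (p.2 : E)) := by
  refine Continuous.measurableEmbedding (by fun_prop) fun p q hpq => ?_
  have h1 := congrArg (fun x => ⟪h.normal, x⟫) hpq
  simp only [inner_add_right, inner_smul_right, h.inner_normal_self, h.inner_normal_coe] at h1
  have h2 : p.1 = q.1 := by linarith
  simp only [h2, add_right_inj] at hpq
  exact Prod.ext h2 (Subtype.ext hpq)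

/-- Fubini coordinates along the normal, with Jacobian `ε`. The substitution is a measurable
embedding, so no integrability of `G` is required. -/
theorem integral_eq_mul_integral_param_sub {ε : ℝ} (hε : 0 < ε) (G : E → ℂ) :
    ∫ x, G x = (ε : ℂ) * ∫ p : ℝ × h.Space, G (h.param p.2 - (ε * p.1) • h.normal) := by
  have hm : Measure.map (fun s : ℝ => h.offset - ε * s) volume = ENNReal.ofReal ε⁻¹ • volume := by
    have h1 : (fun s : ℝ => h.offset - ε * s) = (fun s => h.offset + s) ∘ (fun s => (-ε) * s) := by
      ext s; simp; ring
    rw [h1, ← Measure.map_map (by fun_prop) (by fun_prop),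
      Real.map_volume_mul_left (neg_ne_zero.2 hε.ne'), Measure.map_smul, map_add_left_eq_self,
      inv_neg, abs_neg, abs_of_pos (inv_pos.2 hε)]
  have he : MeasurableEmbedding (fun s : ℝ => h.offset - ε * s) := by
    refine Continuous.measurableEmbedding (by fun_prop) fun s t hst => ?_
    have : ε * s = ε * t := by simpa using hst
    exact mul_left_cancel₀ hε.ne' this
  have hprod : Measure.map (Prod.map (fun s : ℝ => h.offset - ε * s) (id : h.Space → h.Space))
      (volume.prod volume) = ENNReal.ofReal ε⁻¹ • (volume.prod volume) := by
    rw [← Measure.map_prod_map _ _ (by fun_prop) measurable_id, hm, Measure.map_id,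
      Measure.prod_smul_left]
  rw [← h.measurePreserving_smul_normal_add.integral_comp h.measurableEmbedding_smul_normal_add G]
  have hint := (he.prodMap (MeasurableEmbedding.id (α := h.Space))).integral_map
    (μ := volume.prod volume) (fun p : ℝ × h.Space => G (p.1 • h.normal + (p.2 : E)))
  rw [hprod, integral_smul_measure, ENNReal.toReal_ofReal (inv_pos.2 hε).le] at hint
  have h2 : ∀ p : ℝ × h.Space, h.param p.2 - (ε * p.1) • h.normal =
      (Prod.map (fun s : ℝ => h.offset - ε * s) (id : h.Space → h.Space) p).1 • h.normal +
      ((Prod.map (fun s : ℝ => h.offset - ε * s) (id : h.Space → h.Space) p).2 : E) := by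
    intro p
    simp only [param, Prod.map_fst, Prod.map_snd, id, sub_smul]
    abel
  simp only [h2]
  change _ = (ε : ℂ) * ∫ p, _ ∂(volume.prod volume)
  rw [← hint, Complex.real_smul, ← mul_assoc, ← Complex.ofReal_mul, mul_inv_cancel₀ hε.ne',
    Complex.ofReal_one, one_mul]
  rfl

end OrientedHyperplane

theorem ae_inner_param_ne_offset {v : E} {h h' : OrientedHyperplane E} (hv : 0 < ⟪h.normal, v⟫)
    (hv' : 0 < ⟪h'.normal, v⟫) (hne : h' ≠ h) :
    ∀ᵐ y : h.Space, ⟪h'.normal, h.param y⟫ ≠ h'.offset := by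
  by_cases ha : ∃ μ : ℝ, h'.normal = μ • h.normal
  · obtain ⟨μ, hμ⟩ := ha
    have hn := OrientedHyperplane.eq_of_normal_eq_smul hv hv' hμ
    refine Eventually.of_forall fun y hy => hne ?_
    rw [hn, h.inner_normal_param] at hy
    exact OrientedHyperplane.ext_normal_offset hn hy.symm
  · push Not at ha
    exact ae_inner_param_ne h ha _

/-- Integration by parts in the direction `v`, for a polyhedral function `f` and an exponential such
that their product decays exponentially. -/
theorem integral_stokes {f : E → ℝ} (hf : f ∈ polyhedralFunctions E) (z : E →L[ℝ] ℂ) {C δ : ℝ}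
    (hδ : 0 < δ) (hdec : ∀ x, ‖(f x : ℂ) * Complex.exp (z x)‖ ≤ C * Real.exp (-δ * ‖x‖)) {v : E}
    {H : Finset (OrientedHyperplane E)} (hH : ∀ h ∈ H, 0 < ⟪h.normal, v⟫)
    (hcov : CoversJumps f H v) :
    z v * ∫ x, (f x : ℂ) * Complex.exp (z x) =
      -∑ h ∈ H, (⟪h.normal, v⟫ : ℂ) *
        ∫ y : h.Space, (signedSection f h y : ℂ) * Complex.exp (z (h.param y)) := by
  have hmeas := measurable_polyhedral hf
  have hC : 0 ≤ C := by
    have := (norm_nonneg _).trans (hdec 0)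
    exact nonneg_of_mul_nonneg_left this (Real.exp_pos _)
  have hint : Integrable (fun x => (f x : ℂ) * Complex.exp (z x)) :=
    ((integrable_exp_neg_mul_norm volume hδ).const_mul C).mono'
      (by fun_prop) (Eventually.of_forall hdec)
  -- `M` pays for replacing `x` by `x + ε v` with `ε ≤ 1`, both in the exponential of `z` and in the
  -- decaying bound.
  set M := Real.exp (δ * ‖v‖ + ‖z v‖) with hM
  have hM1 : 1 ≤ M := Real.one_le_exp (by positivity)
  have hshift : ∀ ε : ℝ, ∀ x, (f (x + ε • v) : ℂ) * Complex.exp (z x) =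
      Complex.exp (-(ε * z v)) * ((f (x + ε • v) : ℂ) * Complex.exp (z (x + ε • v))) := by
    intro ε x
    rw [map_add, map_smul, Complex.real_smul, Complex.exp_add, Complex.exp_neg]
    field_simp
  have hbound : ∀ ε : ℝ, 0 < ε → ε ≤ 1 → ∀ h ∈ H, ∀ x,
      ‖(jumpShare f H v ε h x : ℂ) * Complex.exp (z x)‖ ≤
        crossing v ε h x * (2 * M * C * Real.exp (-δ * ‖x‖)) := by
    intro ε hε hε1 h hh x
    have e1 : |f (x + ε • v)| * ‖Complex.exp (z x)‖ ≤ M * C * Real.exp (-δ * ‖x‖) := by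
      have e2 := hdec (x + ε • v)
      have e3 : |f (x + ε • v)| * ‖Complex.exp (z x)‖ =
          ‖(f (x + ε • v) : ℂ) * Complex.exp (z x)‖ := by
        rw [norm_mul, Complex.norm_real, Real.norm_eq_abs]
      rw [e3, hshift, norm_mul]
      have e4 : ‖Complex.exp (-(ε * z v))‖ ≤ Real.exp ‖z v‖ := by
        rw [Complex.norm_exp]
        refine Real.exp_le_exp.2 ((Complex.re_le_norm _).trans ?_)
        rw [norm_neg, norm_mul, Complex.norm_real, Real.norm_eq_abs, abs_of_pos hε]
        exact mul_le_of_le_one_left (norm_nonneg _) hε1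
      have e5 : Real.exp (-δ * ‖x + ε • v‖) ≤ Real.exp (δ * ‖v‖) * Real.exp (-δ * ‖x‖) := by
        rw [← Real.exp_add]
        refine Real.exp_le_exp.2 ?_
        have e6 : ‖x‖ ≤ ‖x + ε • v‖ + ‖v‖ := by
          have := norm_sub_le (x + ε • v) (ε • v)
          rw [add_sub_cancel_right, norm_smul, Real.norm_eq_abs, abs_of_pos hε] at this
          nlinarith [norm_nonneg v]
        nlinarith
      calc _ ≤ Real.exp ‖z v‖ * (C * (Real.exp (δ * ‖v‖) * Real.exp (-δ * ‖x‖))) :=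
            mul_le_mul e4 (e2.trans (mul_le_mul_of_nonneg_left e5 hC)) (norm_nonneg _)
              (Real.exp_pos _).le
        _ = M * C * Real.exp (-δ * ‖x‖) := by rw [hM, Real.exp_add]; ring
    have e2 : |f x| * ‖Complex.exp (z x)‖ ≤ M * C * Real.exp (-δ * ‖x‖) := by
      have e3 := hdec x
      rw [norm_mul, Complex.norm_real, Real.norm_eq_abs] at e3
      refine e3.trans ?_
      rw [mul_assoc]
      exact le_mul_of_one_le_left (mul_nonneg hC (Real.exp_pos _).le) hM1
    rw [norm_mul, Complex.norm_real, Real.norm_eq_abs]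
    calc _ ≤ crossing v ε h x * (|f (x + ε • v)| + |f x|) * ‖Complex.exp (z x)‖ :=
          mul_le_mul_of_nonneg_right (abs_jumpShare_le f v ε hh x) (norm_nonneg _)
      _ = crossing v ε h x * (|f (x + ε • v)| * ‖Complex.exp (z x)‖ +
            |f x| * ‖Complex.exp (z x)‖) := by ring
      _ ≤ crossing v ε h x * (M * C * Real.exp (-δ * ‖x‖) + M * C * Real.exp (-δ * ‖x‖)) :=
          mul_le_mul_of_nonneg_left (add_le_add e1 e2) (crossing_nonneg _ _ _ _)
      _ = _ := by ring
  have hjm : ∀ ε h, Measurable fun x => (jumpShare f H v ε h x : ℂ) * Complex.exp (z x) :=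
    fun ε h => (Complex.measurable_ofReal.comp (measurable_jumpShare hmeas H v ε h)).mul
      (by fun_prop)
  have hcr1 : ∀ ε h x, crossing v ε h x ≤ 1 := fun ε h x => by
    unfold crossing; split_ifs <;> norm_num
  -- Translation invariance turns the integral of the increment into a multiple of the original
  -- integral. On the other side the increment is split among the hyperplanes, and the Jacobian `ε`
  -- will cancel in the difference quotient.
  have hincr : ∀ ε : ℝ, 0 < ε → ε ≤ 1 →
      (Complex.exp (-(ε * z v)) - 1) * ∫ x, (f x : ℂ) * Complex.exp (z x) =
        (ε : ℂ) * ∑ h ∈ H, ∫ p : ℝ × h.Space,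
          (jumpShare f H v ε h (h.param p.2 - (ε * p.1) • h.normal) : ℂ) *
            Complex.exp (z (h.param p.2 - (ε * p.1) • h.normal)) := by
    intro ε hε hε1
    have hi : Integrable (fun x => (f (x + ε • v) : ℂ) * Complex.exp (z (x + ε • v))) :=
      hint.comp_add_right (ε • v)
    have e1 : ∫ x, (f (x + ε • v) : ℂ) * Complex.exp (z x) =
        Complex.exp (-(ε * z v)) * ∫ x, (f x : ℂ) * Complex.exp (z x) := by
      simp only [hshift ε]
      rw [integral_const_mul,
        integral_add_right_eq_self (fun x => (f x : ℂ) * Complex.exp (z x)) (ε • v)]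
    have e2 : Integrable (fun x => (f (x + ε • v) : ℂ) * Complex.exp (z x)) := by
      simp only [hshift ε]
      exact hi.const_mul _
    rw [sub_mul, one_mul, ← e1, ← integral_sub e2 hint, Finset.mul_sum]
    have e3 : ∀ x, (f (x + ε • v) : ℂ) * Complex.exp (z x) - (f x : ℂ) * Complex.exp (z x) =
        ∑ h ∈ H, (jumpShare f H v ε h x : ℂ) * Complex.exp (z x) := by
      intro x
      rw [← sub_mul, ← Complex.ofReal_sub, ← sum_jumpShare hcov hε x, Complex.ofReal_sum,
        Finset.sum_mul]
    simp only [e3]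
    rw [integral_finsetSum]
    · exact Finset.sum_congr rfl fun h _ => h.integral_eq_mul_integral_param_sub hε _
    · intro h hh
      refine ((integrable_exp_neg_mul_norm volume hδ).const_mul (2 * M * C)).mono'
        (hjm ε h).aestronglyMeasurable (Eventually.of_forall fun x => ?_)
      refine (hbound ε hε hε1 h hh x).trans ?_
      exact mul_le_of_le_one_left (by positivity) (hcr1 _ _ _)
  have hlim : ∀ h ∈ H, Tendsto (fun ε : ℝ => ∫ p : ℝ × h.Space,
      (jumpShare f H v ε h (h.param p.2 - (ε * p.1) • h.normal) : ℂ) *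
        Complex.exp (z (h.param p.2 - (ε * p.1) • h.normal))) (𝓝[>] 0)
      (𝓝 ((⟪h.normal, v⟫ : ℂ) *
        ∫ y : h.Space, (signedSection f h y : ℂ) * Complex.exp (z (h.param y)))) := by
    intro h hh
    have hval : (⟪h.normal, v⟫ : ℂ) *
        ∫ y : h.Space, (signedSection f h y : ℂ) * Complex.exp (z (h.param y)) =
        ∫ p : ℝ × h.Space, (Set.Icc 0 ⟪h.normal, v⟫).indicator (fun _ => (1 : ℂ)) p.1 *
          ((signedSection f h p.2 : ℂ) * Complex.exp (z (h.param p.2))) := by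
      change _ = ∫ p : ℝ × h.Space, _ ∂(volume.prod volume)
      rw [integral_prod_mul (fun s => (Set.Icc 0 ⟪h.normal, v⟫).indicator (fun _ => (1 : ℂ)) s)
        (fun y => (signedSection f h y : ℂ) * Complex.exp (z (h.param y)))]
      congr 1
      rw [integral_indicator measurableSet_Icc]
      simp [(hH h hh).le]
    rw [hval]
    have hcont : ∀ ε : ℝ, Continuous fun p : ℝ × h.Space =>
        h.param p.2 - (ε * p.1) • h.normal := fun ε =>
      (h.continuous_param.comp continuous_snd).sub
        ((continuous_const.mul continuous_fst).smul continuous_const)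
    refine tendsto_integral_filter_of_dominated_convergence
      (fun p : ℝ × h.Space => (Set.Icc 0 ⟪h.normal, v⟫).indicator (fun _ => (1 : ℝ)) p.1 *
        (2 * M * C * Real.exp (-δ * ‖p.2‖))) ?_ ?_ ?_ ?_
    · exact Eventually.of_forall fun ε =>
        ((hjm ε h).comp (hcont ε).measurable).aestronglyMeasurable
    · filter_upwards [Ioc_mem_nhdsGT (zero_lt_one' ℝ)] with ε hε
      refine Eventually.of_forall fun p => (hbound ε hε.1 hε.2 h hh _).trans ?_
      rw [crossing_param_sub hε.1]
      refine mul_le_mul_of_nonneg_left (mul_le_mul_of_nonneg_left ?_ (by positivity))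
        (Set.indicator_nonneg (fun _ _ => zero_le_one) _)
      refine Real.exp_le_exp.2 ?_
      have := h.norm_le_norm_param_sub p.2 (ε * p.1)
      nlinarith
    · refine Integrable.mul_prod (f := fun s => (Set.Icc 0 ⟪h.normal, v⟫).indicator
        (fun _ => (1 : ℝ)) s) (g := fun y : h.Space => 2 * M * C * Real.exp (-δ * ‖y‖)) ?_ ?_
      · exact (integrable_indicator_iff measurableSet_Icc).2 (by simp)
      · exact (integrable_exp_neg_mul_norm volume hδ).const_mul _
    -- Pointwise convergence fails at most on null sets: `s` at an end of the interval, or `y`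
    -- without side values or on another hyperplane of `H`. Distinct members of `H` meet in null
    -- sets because `v` orients them all, so none is the reverse of another.
    · have hy : ∀ᵐ y : h.Space, (∃ a b, HasSideValues f h y a b) ∧
          ∀ h' ∈ H, h' ≠ h → ⟪h'.normal, h.param y⟫ ≠ h'.offset := by
        refine (ae_exists_sideValues hf h).and ((ae_ball_iff H.countable_toSet).2 fun h' hh' => ?_)
        by_cases hne : h' = h
        · exact Eventually.of_forall fun _ h0 => absurd hne h0
        · filter_upwards [ae_inner_param_ne_offset (hH h hh) (hH h' hh') hne] with y hy _ using hy
      have hs : ∀ᵐ s : ℝ, s ≠ 0 ∧ s ≠ ⟪h.normal, v⟫ :=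
        (Measure.ae_ne volume _).and (Measure.ae_ne volume _)
      filter_upwards [Measure.quasiMeasurePreserving_fst.ae hs,
        Measure.quasiMeasurePreserving_snd.ae hy] with p hp1 hp2
      obtain ⟨⟨a, b, hab⟩, hp3⟩ := hp2
      by_cases hmem : p.1 ∈ Set.Icc 0 ⟪h.normal, v⟫
      · have hs1 := lt_of_le_of_ne hmem.1 hp1.1.symm
        have hs2 := lt_of_le_of_ne hmem.2 hp1.2
        rw [Set.indicator_of_mem hmem, one_mul, hab.signedSection_eq]
        have hexp : Tendsto (fun ε : ℝ => ((a - b : ℝ) : ℂ) *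
            Complex.exp (z (h.param p.2 - (ε * p.1) • h.normal))) (𝓝[>] 0)
            (𝓝 (((a - b : ℝ) : ℂ) * Complex.exp (z (h.param p.2)))) := by
          have : Continuous fun ε : ℝ => ((a - b : ℝ) : ℂ) *
            Complex.exp (z (h.param p.2 - (ε * p.1) • h.normal)) := by fun_prop
          simpa using (this.tendsto 0).mono_left nhdsWithin_le_nhds
        refine hexp.congr' ?_
        filter_upwards [eventually_jumpShare_eq hh hp3 hab hs1 hs2] with ε hε
        rw [hε]
      · rw [Set.indicator_of_notMem hmem, zero_mul]
        refine tendsto_const_nhds.congr' ?_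
        filter_upwards [self_mem_nhdsWithin] with ε hε
        rw [jumpShare, crossing_param_sub hε, Set.indicator_of_notMem hmem]
        simp
  -- The derivative at 0 of `exp (-ε z(v))` produces the factor `-z v`.
  have hleft : Tendsto (fun ε : ℝ => (ε : ℂ)⁻¹ * ((Complex.exp (-(ε * z v)) - 1) *
      ∫ x, (f x : ℂ) * Complex.exp (z x))) (𝓝[>] 0)
      (𝓝 (-z v * ∫ x, (f x : ℂ) * Complex.exp (z x))) := by
    have hd : HasDerivAt (fun ε : ℝ => Complex.exp (-(ε * z v))) (-z v) 0 := by
      have h1 : HasDerivAt (fun ε : ℝ => -((ε : ℂ) * z v)) (-(1 * z v)) 0 :=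
        ((hasDerivAt_id (0 : ℝ)).ofReal_comp.mul_const (z v)).neg
      simpa using h1.cexp
    have h2 := hd.tendsto_slope_zero_right
    have h3 := h2.mul_const (∫ x, (f x : ℂ) * Complex.exp (z x))
    refine h3.congr fun ε => ?_
    simp [mul_assoc]
  have hright := tendsto_finsetSum H hlim
  have := tendsto_nhds_unique hleft (hright.congr' ?_)
  · rw [← this]; ring
  · filter_upwards [Ioc_mem_nhdsGT (zero_lt_one' ℝ)] with ε hε
    rw [hincr ε hε.1 hε.2, ← mul_assoc, inv_mul_cancel₀ (Complex.ofReal_ne_zero.2 hε.1.ne'), one_mul]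

end Stokes

/-! ### Frequencies of exponential decay, and passage to all frequencies of absolute convergence. -/

section Decay

theorem integral_indicatorFn_mul {E : Type*} [MeasurableSpace E] {μ : Measure E} {P : Set E} (hP : MeasurableSet P)
    (G : E → ℂ) : ∫ x, (indicatorFn P x : ℂ) * G x ∂μ = ∫ x in P, G x ∂μ := by
  rw [← integral_indicator hP]
  refine integral_congr_ae (Eventually.of_forall fun x => ?_)
  by_cases hx : x ∈ P <;> simp [indicatorFn, hx]

variable {E : Type*} [NormedAddCommGroup E] [InnerProductSpace ℝ E]

/-- The frequencies `z` such that `exp z` decays exponentially on `P`. -/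
def decayFreq (P : Set E) : Set (E →L[ℝ] ℂ) :=
  {z | ∃ δ > 0, ∃ C, ∀ x ∈ P, (z x).re ≤ C - δ * ‖x‖}

theorem isOpen_decayFreq (P : Set E) : IsOpen (decayFreq P) := by
  refine Metric.isOpen_iff.2 fun z hz => ?_
  obtain ⟨δ, hδ, C, hC⟩ := hz
  refine ⟨δ / 2, by positivity, fun w hw => ⟨δ / 2, by positivity, C, fun x hx => ?_⟩⟩
  have h1 : ‖(w - z) x‖ ≤ δ / 2 * ‖x‖ :=
    (ContinuousLinearMap.le_opNorm _ _).trans (mul_le_mul_of_nonneg_right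
      (mem_ball_iff_norm.1 hw).le (norm_nonneg _))
  have h2 := (Complex.re_le_norm _).trans h1
  rw [_root_.sub_apply, Complex.sub_re] at h2
  have := hC x hx
  linarith

/-- The sum of the constraint normals works. Each `⟪a, x⟫` is bounded above on the polyhedron, so
the sum is at most a constant minus the sum of the `|⟪a, x⟫|`, which dominates a multiple of `‖x‖`
because the normals have no common kernel. -/
theorem decayFreq_nonempty [FiniteDimensional ℝ E] (s : Finset (E × ℝ))
    (hs : ∀ w, (∀ ab ∈ s, ⟪ab.1, w⟫ = 0) → w = 0) :
    (decayFreq {x | ∀ ab ∈ s, ⟪ab.1, x⟫ ≤ ab.2}).Nonempty := by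
  let L : E →ₗ[ℝ] (s → ℝ) := LinearMap.pi fun ab => (innerSL ℝ (ab : E × ℝ).1).toLinearMap
  have hL : LinearMap.ker L = ⊥ := by
    refine LinearMap.ker_eq_bot'.2 fun w hw => hs w fun ab hab => ?_
    exact congrFun hw ⟨ab, hab⟩
  obtain ⟨K, hK, hLK⟩ := L.exists_antilipschitzWith hL
  have hK' : (0 : ℝ) < K := by exact_mod_cast hK
  have hLK' : ∀ x, ‖x‖ ≤ K * ∑ ab ∈ s, |⟪ab.1, x⟫| := fun x => by
    have h1 : ‖x‖ ≤ K * ‖L x‖ := by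
      have := hLK.le_mul_dist x 0
      simpa using this
    refine h1.trans (mul_le_mul_of_nonneg_left ?_ hK'.le)
    refine (pi_norm_le_iff_of_nonneg (Finset.sum_nonneg fun _ _ => abs_nonneg _)).2 fun ab => ?_
    exact Finset.single_le_sum (f := fun ab : E × ℝ => |⟪ab.1, x⟫|) (fun _ _ => abs_nonneg _) ab.2
  refine ⟨Complex.ofRealCLM.comp (innerSL ℝ (∑ ab ∈ s, ab.1)), (K : ℝ)⁻¹, inv_pos.2 hK',
    ∑ ab ∈ s, (ab.2 + |ab.2|), fun x hx => ?_⟩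
  have h1 : ((Complex.ofRealCLM.comp (innerSL ℝ (∑ ab ∈ s, ab.1))) x).re =
      ∑ ab ∈ s, ⟪ab.1, x⟫ := by
    change ⟪∑ ab ∈ s, ab.1, x⟫ = _
    exact sum_inner _ _ _
  have h2 : (K : ℝ)⁻¹ * ‖x‖ ≤ ∑ ab ∈ s, |⟪ab.1, x⟫| := by
    rw [inv_mul_le_iff₀ hK']; exact hLK' x
  have h3 : ∑ ab ∈ s, (⟪ab.1, x⟫ + |⟪ab.1, x⟫|) ≤ ∑ ab ∈ s, (ab.2 + |ab.2|) := by
    refine Finset.sum_le_sum fun ab hab => ?_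
    have h4 := hx ab hab
    rcases le_total 0 ⟪ab.1, x⟫ with h5 | h5
    · rw [abs_of_nonneg h5, abs_of_nonneg (h5.trans h4)]; linarith
    · rw [abs_of_nonpos h5]
      have := neg_abs_le ab.2
      linarith
  rw [Finset.sum_add_distrib] at h3
  rw [h1]
  linarith

theorem restrictFreq_mem_decayFreq {P : Set E} {z : E →L[ℝ] ℂ} (hz : z ∈ decayFreq P)
    (h : OrientedHyperplane E) : restrictFreq h.Space z ∈ decayFreq (h.param ⁻¹' P) := by
  obtain ⟨δ, hδ, C, hC⟩ := hz
  refine ⟨δ, hδ, C - (z (h.offset • h.normal)).re, fun y hy => ?_⟩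
  have h1 := hC _ hy
  have h2 := h.norm_le_norm_param_sub y 0
  rw [zero_smul, sub_zero] at h2
  have h3 : (z (h.param y)).re = (z (h.offset • h.normal)).re + (z (y : E)).re := by
    rw [OrientedHyperplane.param, map_add, Complex.add_re]
  rw [restrictFreq_apply]
  nlinarith

theorem norm_indicatorFn_mul_exp_le {P : Set E} {z : E →L[ℝ] ℂ} {δ C : ℝ}
    (hC : ∀ x ∈ P, (z x).re ≤ C - δ * ‖x‖) (x : E) :
    ‖(indicatorFn P x : ℂ) * Complex.exp (z x)‖ ≤ Real.exp C * Real.exp (-δ * ‖x‖) := by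
  by_cases hx : x ∈ P
  · rw [indicatorFn, Set.indicator_of_mem hx, Complex.ofReal_one, one_mul, Complex.norm_exp,
      ← Real.exp_add]
    refine Real.exp_le_exp.2 ((hC x hx).trans_eq (by ring))
  · rw [indicatorFn, Set.indicator_of_notMem hx, Complex.ofReal_zero, zero_mul, norm_zero]
    positivity

variable [FiniteDimensional ℝ E] [MeasurableSpace E] [BorelSpace E]

theorem integrableOn_exp_of_mem_decayFreq {P : Set E} (hP : MeasurableSet P) {z : E →L[ℝ] ℂ}
    (hz : z ∈ decayFreq P) : IntegrableOn (fun x => Complex.exp (z x)) P := by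
  obtain ⟨δ, hδ, C, hC⟩ := hz
  refine Integrable.mono' ((integrable_exp_neg_mul_norm volume hδ).const_mul
    (Real.exp C)).integrableOn (by fun_prop) ?_
  refine (ae_restrict_iff' hP).2 (Eventually.of_forall fun x hx => ?_)
  have := norm_indicatorFn_mul_exp_le hC x
  rwa [indicatorFn, Set.indicator_of_mem hx, Complex.ofReal_one, one_mul] at this

/-- For `x` in `P`, convexity puts a ball of fixed radius around the midpoint of `x` and an interior
point inside `P`. On it the real part of `z` is at least half of its value at `x` up to a constant,
so a large value would make the integral too large. -/
theorem exists_re_le_of_integrableOn {P : Set E} (hP : Convex ℝ P) (hP' : (interior P).Nonempty)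
    {z : E →L[ℝ] ℂ} (hz : IntegrableOn (fun x => Complex.exp (z x)) P) :
    ∃ M, ∀ x ∈ P, (z x).re ≤ M := by
  obtain ⟨x₀, hx₀⟩ := hP'
  obtain ⟨r, hr, hball⟩ := Metric.isOpen_iff.1 isOpen_interior x₀ hx₀
  set V := (volume : Measure E).real (Metric.ball 0 (r / 2))
  set J := ∫ x in P, ‖Complex.exp (z x)‖
  have hV : 0 < V := ENNReal.toReal_pos
    (Metric.measure_ball_pos volume _ (by positivity)).ne' measure_ball_lt_top.ne
  refine ⟨2 * (J / V) - (z x₀).re + ‖z‖ * r, fun x hx => ?_⟩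
  set m := (1 / 2 : ℝ) • (x + x₀)
  have hsub : Metric.ball m (r / 2) ⊆ P := by
    intro u hu
    have h1 : (2 : ℝ) • u - x ∈ P := by
      refine interior_subset (hball (mem_ball_iff_norm.2 ?_))
      have h2 : (2 : ℝ) • u - x - x₀ = (2 : ℝ) • (u - m) := by
        simp only [m]
        module
      rw [h2, norm_smul, Real.norm_two]
      have := mem_ball_iff_norm.1 hu
      linarith
    have h3 := hP hx h1 (by norm_num : (0 : ℝ) ≤ 1 / 2) (by norm_num : (0 : ℝ) ≤ 1 / 2) (by norm_num)
    have h4 : (1 / 2 : ℝ) • x + (1 / 2 : ℝ) • ((2 : ℝ) • u - x) = u := by module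
    rwa [h4] at h3
  set t := ((z x).re + (z x₀).re) / 2 - ‖z‖ * (r / 2)
  have hlow : ∀ u ∈ Metric.ball m (r / 2), Real.exp t ≤ ‖Complex.exp (z u)‖ := by
    intro u hu
    rw [Complex.norm_exp]
    refine Real.exp_le_exp.2 ?_
    have h1 : ‖z (m - u)‖ ≤ ‖z‖ * (r / 2) := (z.le_opNorm _).trans
      (mul_le_mul_of_nonneg_left (by
        rw [norm_sub_rev]; exact (mem_ball_iff_norm.1 hu).le) (norm_nonneg _))
    have h2 := (Complex.re_le_norm _).trans h1
    have h3 : (z m).re = ((z x).re + (z x₀).re) / 2 := by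
      simp only [m, map_smul, map_add, Complex.real_smul, Complex.re_ofReal_mul, Complex.add_re]
      ring
    rw [map_sub, Complex.sub_re, h3] at h2
    simp only [t]
    linarith
  have h1 : Real.exp t * V ≤ J := by
    have h2 := setIntegral_ge_of_const_le_real (μ := volume) measurableSet_ball
      measure_ball_lt_top.ne hlow (IntegrableOn.mono_set hz.norm hsub)
    have h3 : ∫ u in Metric.ball m (r / 2), ‖Complex.exp (z u)‖ ≤ J :=
      setIntegral_mono_set hz.norm (Eventually.of_forall fun _ => norm_nonneg _)
        (LE.le.eventuallyLE hsub)
    have h4 : (volume : Measure E).real (Metric.ball m (r / 2)) = V := by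
      simp only [V, Measure.real, Measure.addHaar_ball_center]
    rw [h4] at h2
    exact h2.trans h3
  have h2 : t ≤ J / V := by
    rw [le_div_iff₀ hV]
    exact (mul_le_mul_of_nonneg_right ((Real.add_one_le_exp t).trans' (by linarith)) hV.le).trans h1
  simp only [t] at h2
  linarith

theorem volume_eq_zero_of_interior_eq_empty {P : Set E} (hP : Convex ℝ P) (hP' : IsClosed P)
    (h : interior P = ∅) : volume P = 0 := by
  have := hP.addHaar_frontier (volume : Measure E)
  rwa [hP'.frontier_eq, h, Set.sdiff_empty] at this

/-- An integrable `z` is a boundary limit: its real part is bounded above on `P`, so every point of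
the segment towards a decaying `z₁`, except possibly `z`, is decaying. Dominated convergence along
the segment carries the identity to `z`. If `P` has empty interior it is a null set, and both sides
are 0. -/
theorem Represents.of_decayFreq {P : Set E} (hP : IsPolyhedron P) (hne : (decayFreq P).Nonempty)
    {F : MeromorphicFunctions E}
    (hF : Represents F (decayFreq P) fun z => ∫ x in P, Complex.exp (z x)) :
    Represents F {z | IntegrableOn (fun x => Complex.exp (z x)) P}
      fun z => ∫ x in P, Complex.exp (z x) := by
  obtain ⟨p, q, hq, h1, h2⟩ := hF
  refine ⟨p, q, hq, h1, fun z hz => ?_⟩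
  have hPm := (isClosed_polyhedron hP).measurableSet
  rcases Set.eq_empty_or_nonempty (interior P) with hemp | hint
  · have h3 := volume_eq_zero_of_interior_eq_empty (convex_polyhedron hP) (isClosed_polyhedron hP) hemp
    have h4 : p = 0 := entire_eq_of_eqOn_open (isOpen_decayFreq P) hne fun w hw => by
      rw [← h2 w hw]
      simp only [setIntegral_measure_zero _ h3, mul_zero]
      rfl
    simp only [h4, setIntegral_measure_zero _ h3, mul_zero]
    rfl
  obtain ⟨M, hM⟩ := exists_re_le_of_integrableOn (convex_polyhedron hP) hint hz
  obtain ⟨z₁, hz₁⟩ := hne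
  have hz₁' := integrableOn_exp_of_mem_decayFreq hPm hz₁
  obtain ⟨δ, hδ, C, hC⟩ := hz₁
  have hre : ∀ (t : ℝ) x, ((z + t • (z₁ - z)) x).re = (1 - t) * (z x).re + t * (z₁ x).re := by
    intro t x
    simp only [_root_.add_apply, _root_.smul_apply,
      _root_.sub_apply, Complex.add_re, Complex.real_smul, Complex.re_ofReal_mul,
      Complex.sub_re]
    ring
  have hpath : Continuous fun t : ℝ => z + t • (z₁ - z) := by fun_prop
  have hpath0 : Tendsto (fun t : ℝ => z + t • (z₁ - z)) (𝓝[>] 0) (𝓝 z) := by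
    have := (hpath.tendsto 0).mono_left (nhdsWithin_le_nhds (s := Set.Ioi 0))
    have h0 : z + (0 : ℝ) • (z₁ - z) = z := by ext x; simp
    rwa [h0] at this
  have hIoc := Ioc_mem_nhdsGT (zero_lt_one' ℝ)
  have hlimI : Tendsto (fun t : ℝ => ∫ x in P, Complex.exp ((z + t • (z₁ - z)) x)) (𝓝[>] 0)
      (𝓝 (∫ x in P, Complex.exp (z x))) := by
    refine tendsto_integral_filter_of_dominated_convergence
      (fun x => ‖Complex.exp (z x)‖ + ‖Complex.exp (z₁ x)‖) ?_ ?_ (hz.norm.add hz₁'.norm) ?_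
    · exact Eventually.of_forall fun t => by fun_prop
    · filter_upwards [hIoc] with t ht
      refine Eventually.of_forall fun x => ?_
      simp only [Complex.norm_exp, hre]
      rcases le_total (z x).re (z₁ x).re with h | h
      · have : Real.exp ((1 - t) * (z x).re + t * (z₁ x).re) ≤ Real.exp (z₁ x).re :=
          Real.exp_le_exp.2 (by nlinarith [ht.1, ht.2])
        linarith [Real.exp_pos (z x).re]
      · have : Real.exp ((1 - t) * (z x).re + t * (z₁ x).re) ≤ Real.exp (z x).re :=
          Real.exp_le_exp.2 (by nlinarith [ht.1, ht.2])
        linarith [Real.exp_pos (z₁ x).re]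
    · refine Eventually.of_forall fun x => ?_
      have : Continuous fun t : ℝ => Complex.exp ((z + t • (z₁ - z)) x) := by
        simp only [_root_.add_apply, _root_.smul_apply]
        fun_prop
      simpa using (this.tendsto 0).mono_left nhdsWithin_le_nhds
  have hl := (((continuous_entire q).tendsto z).comp hpath0).mul hlimI
  have hr := ((continuous_entire p).tendsto z).comp hpath0
  refine tendsto_nhds_unique hl (hr.congr' ?_)
  filter_upwards [hIoc] with t ht
  refine (h2 _ ⟨t * δ, mul_pos ht.1 hδ, (1 - t) * M + t * C, fun x hx => ?_⟩).symm
  rw [hre]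
  have e1 := mul_le_mul_of_nonneg_left (hM x hx) (sub_nonneg.2 ht.2)
  have e2 := mul_le_mul_of_nonneg_left (hC x hx) ht.1.le
  linarith

end Decay

/-! ### Finite families of hyperplanes that contain all jumps. -/

section Covering

variable {E : Type*} [NormedAddCommGroup E] [InnerProductSpace ℝ E]

/-- The boundary hyperplanes of the half-spaces in `s` belong to `H`, up to orientation. -/
def CoversConstraints (H : Finset (OrientedHyperplane E)) (s : Finset (E × ℝ)) : Prop :=
  ∀ ab ∈ s, ab.1 ≠ 0 → ∃ h ∈ H, ∃ μ : ℝ, ab.1 = μ • h.normal ∧ ab.2 = μ * h.offset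

theorem CoversConstraints.mono {H H' : Finset (OrientedHyperplane E)} {s s' : Finset (E × ℝ)}
    (hc : CoversConstraints H s) (hH : H ⊆ H') (hs : s' ⊆ s) : CoversConstraints H' s' :=
  fun ab hab h0 => by
    obtain ⟨h, hh, hμ⟩ := hc ab (hs hab) h0
    exact ⟨h, hH hh, hμ⟩

/-- When the indicator changes between the ends of a segment, some constraint changes its truth
value, and the segment meets the boundary of that constraint. -/
theorem CoversConstraints.coversJumps {H : Finset (OrientedHyperplane E)} {s : Finset (E × ℝ)}
    (hc : CoversConstraints H s) {v : E} (hv : ∀ h ∈ H, 0 < ⟪h.normal, v⟫) :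
    CoversJumps (indicatorFn {x | ∀ ab ∈ s, ⟪ab.1, x⟫ ≤ ab.2}) H v := by
  classical
  intro x ε hε hne
  obtain ⟨ab, hab, hx⟩ : ∃ ab ∈ s, ¬ (⟪ab.1, x + ε • v⟫ ≤ ab.2 ↔ ⟪ab.1, x⟫ ≤ ab.2) := by
    by_contra! hcon
    refine hne ?_
    have : x + ε • v ∈ {x | ∀ ab ∈ s, ⟪ab.1, x⟫ ≤ ab.2} ↔ x ∈ {x | ∀ ab ∈ s, ⟪ab.1, x⟫ ≤ ab.2} :=
      forall₂_congr hcon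
    by_cases hmem : x ∈ {x | ∀ ab ∈ s, ⟪ab.1, x⟫ ≤ ab.2}
    · rw [indicatorFn, Set.indicator_of_mem (this.2 hmem), Set.indicator_of_mem hmem]
    · rw [indicatorFn, Set.indicator_of_notMem (this.not.2 hmem), Set.indicator_of_notMem hmem]
  have h0 : ab.1 ≠ 0 := fun h0 => hx (by rw [h0, inner_zero_left, inner_zero_left])
  obtain ⟨h, hh, μ, h1, h2⟩ := hc ab hab h0
  refine ⟨h, hh, if_pos ?_⟩
  have hnv := mul_pos hε (hv h hh)
  rw [h1, h2, real_inner_smul_left, real_inner_smul_left, inner_add_right, inner_smul_right] at hx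
  by_contra hcon
  refine hx ?_
  rw [not_and_or, not_le, not_le] at hcon
  rcases le_or_gt μ 0 with hμ | hμ
  · rcases hcon with hcon | hcon
    · exact ⟨fun _ => by nlinarith, fun _ => by nlinarith⟩
    · rcases hμ.eq_or_lt with rfl | hμ
      · simp
      · exact ⟨fun _ => by nlinarith, fun _ => by nlinarith⟩
  · rcases hcon with hcon | hcon
    · exact ⟨fun _ => by nlinarith, fun _ => by nlinarith⟩
    · exact ⟨fun _ => by nlinarith, fun _ => by nlinarith⟩

theorem exists_coversConstraints (s : Finset (E × ℝ)) {v : E}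
    (hv : ∀ ab ∈ s, ab.1 ≠ 0 → ⟪ab.1, v⟫ ≠ 0) :
    ∃ H : Finset (OrientedHyperplane E), (∀ h ∈ H, 0 < ⟪h.normal, v⟫) ∧ CoversConstraints H s := by
  classical
  induction s using Finset.induction_on with
  | empty => exact ⟨∅, by simp, fun ab hab => by simp at hab⟩
  | insert ab s _ ih =>
    obtain ⟨H, h1, h2⟩ := ih fun cd hcd => hv cd (Finset.mem_insert_of_mem hcd)
    by_cases h0 : ab.1 = 0
    · refine ⟨H, h1, fun cd hcd hcd0 => ?_⟩
      rcases Finset.mem_insert.1 hcd with rfl | hcd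
      · exact absurd h0 hcd0
      · exact h2 cd hcd hcd0
    have hav := hv ab (Finset.mem_insert_self _ _) h0
    have hn : 0 < ‖ab.1‖ := norm_pos_iff.2 h0
    -- The sign `σ` orients the boundary hyperplane so that `v` points to its positive side.
    obtain ⟨σ, hσ, hσv⟩ : ∃ σ : ℝ, |σ| = 1 ∧ 0 < σ * ⟪ab.1, v⟫ := by
      rcases lt_or_gt_of_ne hav with h | h
      · exact ⟨-1, by simp, by linarith⟩
      · exact ⟨1, by simp, by linarith⟩
    have hσ2 : σ * σ = 1 := by rw [← abs_mul_abs_self, hσ, one_mul]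
    have hunit : ‖(σ / ‖ab.1‖) • ab.1‖ = 1 := by
      rw [norm_smul, norm_div, norm_norm, Real.norm_eq_abs, hσ, one_div, inv_mul_cancel₀ hn.ne']
    refine ⟨insert ⟨(σ / ‖ab.1‖) • ab.1, hunit, σ / ‖ab.1‖ * ab.2⟩ H, ?_, ?_⟩
    · intro h hh
      rcases Finset.mem_insert.1 hh with rfl | hh
      · simp only [real_inner_smul_left]
        rw [div_mul_eq_mul_div]
        exact div_pos hσv hn
      · exact h1 h hh
    · intro cd hcd hcd0
      rcases Finset.mem_insert.1 hcd with rfl | hcd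
      · refine ⟨_, Finset.mem_insert_self _ _, σ * ‖cd.1‖, ?_, ?_⟩
        · simp only [smul_smul]
          rw [mul_assoc, mul_div_cancel₀ _ hn.ne', hσ2, one_smul]
        · simp only
          field_simp
          rw [pow_two, hσ2, mul_one]
      · obtain ⟨h, hh, hμ⟩ := h2 cd hcd hcd0
        exact ⟨h, Finset.mem_insert_of_mem hh, hμ⟩

end Covering

/-! ### Polyhedra without lines, and transverse directions. -/

section Lines

variable {E : Type*} [NormedAddCommGroup E] [InnerProductSpace ℝ E]

theorem inner_eq_zero_of_forall_le {a x w : E} {b : ℝ} (h : ∀ t : ℝ, ⟪a, x + t • w⟫ ≤ b) :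
    ⟪a, w⟫ = 0 := by
  by_contra h0
  have h1 := h ((b - ⟪a, x⟫ + 1) / ⟪a, w⟫)
  rw [inner_add_right, inner_smul_right, div_mul_cancel₀ _ h0] at h1
  linarith

theorem containsLine_iff (s : Finset (E × ℝ)) :
    ContainsLine {x : E | ∀ ab ∈ s, ⟪ab.1, x⟫ ≤ ab.2} ↔
      {x : E | ∀ ab ∈ s, ⟪ab.1, x⟫ ≤ ab.2}.Nonempty ∧ ∃ w : E, w ≠ 0 ∧ ∀ ab ∈ s, ⟪ab.1, w⟫ = 0 := by
  constructor
  · rintro ⟨x, w, hw, h⟩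
    refine ⟨⟨x, by simpa using h 0⟩, w, hw, fun ab hab => ?_⟩
    exact inner_eq_zero_of_forall_le fun t => h t ab hab
  · rintro ⟨⟨x, hx⟩, w, hw, h⟩
    refine ⟨x, w, hw, fun t ab hab => ?_⟩
    rw [inner_add_right, inner_smul_right, h ab hab, mul_zero, add_zero]
    exact hx ab hab

theorem OrientedHyperplane.param_add_smul (h : OrientedHyperplane E) (y w : h.Space) (t : ℝ) :
    h.param (y + t • w) = h.param y + t • (w : E) := by
  simp only [param, Submodule.coe_add, Submodule.coe_smul, add_assoc]

theorem ContainsLine.of_preimage_param {P : Set E} {h : OrientedHyperplane E}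
    (hl : ContainsLine (h.param ⁻¹' P)) : ContainsLine P := by
  obtain ⟨y, w, hw, ht⟩ := hl
  refine ⟨h.param y, w, fun h0 => hw (Subtype.ext h0), fun t => ?_⟩
  rw [← h.param_add_smul]
  exact ht t

theorem decayFreq_nonempty_of_not_containsLine [FiniteDimensional ℝ E] {P : Set E}
    (hP : IsPolyhedron P) (hl : ¬ ContainsLine P) : (decayFreq P).Nonempty := by
  obtain ⟨s, rfl⟩ := hP
  by_cases hs : ∀ w : E, (∀ ab ∈ s, ⟪ab.1, w⟫ = 0) → w = 0
  · exact decayFreq_nonempty s hs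
  · push Not at hs
    obtain ⟨w, hw, hw0⟩ := hs
    -- A direction orthogonal to all normals would give a line through any point, so the polyhedron
    -- is empty and every bound holds on it vacuously.
    refine ⟨0, 1, one_pos, 0, fun x hx => ?_⟩
    exact absurd ((containsLine_iff s).2 ⟨⟨x, hx⟩, w, hw0, hw⟩) hl

/-- A generic vector, negated if necessary. Positivity on `a₀` is used later to keep a prescribed
hyperplane correctly oriented, and to obtain decay along imaginary multiples of `a₀`. -/
theorem exists_direction [FiniteDimensional ℝ E] (s : Finset (E × ℝ)) (a₀ : E) (ha₀ : a₀ ≠ 0) :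
    ∃ v : E, v ≠ 0 ∧ 0 < ⟪a₀, v⟫ ∧ ∃ H : Finset (OrientedHyperplane E),
      (∀ h ∈ H, 0 < ⟪h.normal, v⟫) ∧ CoversConstraints H s := by
  classical
  obtain ⟨v, hv⟩ := exists_inner_ne_zero (insert a₀ ((s.image Prod.fst).erase 0))
    (by simp [ha₀.symm])
  have hv₀ := hv a₀ (Finset.mem_insert_self _ _)
  have hvs : ∀ ab ∈ s, ab.1 ≠ 0 → ⟪ab.1, v⟫ ≠ 0 := fun ab hab h0 => hv _
    (Finset.mem_insert_of_mem (Finset.mem_erase.2 ⟨h0, Finset.mem_image_of_mem _ hab⟩))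
  obtain ⟨v', h1, h2⟩ : ∃ v' : E, 0 < ⟪a₀, v'⟫ ∧ ∀ ab ∈ s, ab.1 ≠ 0 → ⟪ab.1, v'⟫ ≠ 0 := by
    rcases lt_or_gt_of_ne hv₀ with h | h
    · exact ⟨-v, by rw [inner_neg_right]; linarith, fun ab hab h0 => by
        rw [inner_neg_right]; exact neg_ne_zero.2 (hvs ab hab h0)⟩
    · exact ⟨v, h, hvs⟩
  exact ⟨v', fun h0 => by simp [h0] at h1, h1, exists_coversConstraints s h2⟩

end Lines

/-! ### Well-definedness of the transform and the Stokes formula for it, by induction on the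
dimension. -/

section Transform

/-- The constant meromorphic function with a real value. -/
noncomputable abbrev realConst {E : Type*} [NormedAddCommGroup E] [InnerProductSpace ℝ E] (c : ℝ) :
    MeromorphicFunctions E :=
  ofEntire (algebraMap ℂ (entireFunctions E) (c : ℂ))

variable {E : Type*} [NormedAddCommGroup E] [InnerProductSpace ℝ E]
  [FiniteDimensional ℝ E] [MeasurableSpace E] [BorelSpace E]

theorem IsPolyhedronTransform.unique {P : Set E} (hP : IsPolyhedron P)
    {F F' : MeromorphicFunctions E} (hF : IsPolyhedronTransform P F)
    (hF' : IsPolyhedronTransform P F') : F = F' := by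
  rcases hF with ⟨hl, h0⟩ | ⟨hl, h1⟩
  · rcases hF' with ⟨-, h0'⟩ | ⟨hl', -⟩
    · rw [h0, h0']
    · exact absurd hl hl'
  · rcases hF' with ⟨hl', -⟩ | ⟨-, h1'⟩
    · exact absurd hl' hl
    · exact Represents.unique (Z := {z : E →L[ℝ] ℂ | IntegrableOn (fun x => Complex.exp (z x)) P volume})
        (φ := fun z => ∫ x in P, Complex.exp (z x)) h1 h1' (isOpen_decayFreq P)
        (decayFreq_nonempty_of_not_containsLine hP hl) fun z hz =>
          integrableOn_exp_of_mem_decayFreq (isClosed_polyhedron hP).measurableSet hz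

variable (E) in
/-- The span of the pairs of an indicator function of a polyhedron and its transform. -/
def polyhedronGraph : Submodule ℝ ((E → ℝ) × MeromorphicFunctions E) :=
  Submodule.span ℝ
    {gF | ∃ P : Set E, IsPolyhedron P ∧ gF.1 = indicatorFn P ∧ IsPolyhedronTransform P gF.2}

theorem polyhedronGraph_le : polyhedronGraph E ≤ transformGraph E :=
  Submodule.span_mono Set.subset_union_left

theorem null_mem_transformGraph {f : E → ℝ} (hf : f =ᵐ[volume] fun _ => (0 : ℝ)) :
    (f, (0 : MeromorphicFunctions E)) ∈ transformGraph E :=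
  Submodule.subset_span (Or.inr ⟨hf, rfl⟩)

/-- The null generators have transform 0, so they change the function on a null set only and leave
`F` alone. -/
theorem exists_of_mem_transformGraph {f : E → ℝ} {F : MeromorphicFunctions E}
    (h : (f, F) ∈ transformGraph E) : ∃ g, (g, F) ∈ polyhedronGraph E ∧ f =ᵐ[volume] g := by
  rw [transformGraph, Submodule.span_union] at h
  obtain ⟨⟨g, G⟩, h1, ⟨N, K⟩, h2, h3⟩ := Submodule.mem_sup.1 h
  have h4 : ∀ x ∈ Submodule.span ℝ {gF : (E → ℝ) × MeromorphicFunctions E |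
      gF.1 =ᵐ[volume] (fun _ => (0 : ℝ)) ∧ gF.2 = 0},
      x.1 =ᵐ[volume] (fun _ => (0 : ℝ)) ∧ x.2 = 0 := by
    intro x hx
    induction hx using Submodule.span_induction with
    | mem x hx => exact hx
    | zero => exact ⟨EventuallyEq.rfl, rfl⟩
    | add x y _ _ hx hy =>
      refine ⟨?_, ?_⟩
      · filter_upwards [hx.1, hy.1] with u h1 h2
        rw [Prod.fst_add, Pi.add_apply, h1, h2, add_zero]
      · rw [Prod.snd_add, hx.2, hy.2, add_zero]
    | smul c x _ hx =>
      refine ⟨?_, ?_⟩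
      · filter_upwards [hx.1] with u h1
        rw [Prod.smul_fst, Pi.smul_apply, h1, smul_zero]
      · rw [Prod.smul_snd, hx.2, real_smul_eq_ofEntire_mul, mul_zero]
  obtain ⟨h5, rfl⟩ : N =ᵐ[volume] (fun _ => (0 : ℝ)) ∧ K = 0 := h4 _ h2
  obtain ⟨rfl, rfl⟩ := Prod.mk.inj h3
  refine ⟨g, ?_, ?_⟩
  · rwa [add_zero]
  · filter_upwards [h5] with u hu
    rw [Pi.add_apply, hu, add_zero]

theorem fst_mem_of_mem_polyhedronGraph {x : (E → ℝ) × MeromorphicFunctions E}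
    (h : x ∈ polyhedronGraph E) : x.1 ∈ polyhedralFunctions E := by
  induction h using Submodule.span_induction with
  | mem x hx =>
    obtain ⟨P, hP, h1, -⟩ := hx
    rw [h1]
    exact indicatorFn_mem hP
  | zero => exact Submodule.zero_mem _
  | add x y _ _ hx hy => exact Submodule.add_mem _ hx hy
  | smul c x _ hx => exact Submodule.smul_mem _ c hx

variable (E) in
/-- The Fourier–Laplace transform is well-defined on the polyhedral functions on `E`, and its values
are bounded on the sets of frequencies with a given generic real part. -/
def HasTransform : Prop :=
  (∀ P : Set E, IsPolyhedron P → ∃ F, IsPolyhedronTransform P F ∧ IsBoundedOnFibers F) ∧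
    ∀ F, ((0 : E → ℝ), F) ∈ transformGraph E → F = 0

/-- The function `f` is almost everywhere equal to a polyhedral function. -/
def AEPolyhedral (f : E → ℝ) : Prop := ∃ g ∈ polyhedralFunctions E, f =ᵐ[volume] g

theorem AEPolyhedral.of_mem {f : E → ℝ} (hf : f ∈ polyhedralFunctions E) : AEPolyhedral f :=
  ⟨f, hf, EventuallyEq.rfl⟩

namespace HasTransform

theorem unique (hE : HasTransform E) {f : E → ℝ} {F F' : MeromorphicFunctions E}
    (h : (f, F) ∈ transformGraph E) (h' : (f, F') ∈ transformGraph E) : F = F' := by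
  have := Submodule.sub_mem _ h h'
  rw [Prod.mk_sub_mk, sub_self] at this
  exact sub_eq_zero.1 (hE.2 _ this)

theorem fourierLaplace_eq (hE : HasTransform E) {f : E → ℝ} {F : MeromorphicFunctions E}
    (h : (f, F) ∈ transformGraph E) : fourierLaplace f = F := by
  have hex : ∃ F, (f, F) ∈ transformGraph E := ⟨F, h⟩
  rw [fourierLaplace, dif_pos hex]
  exact hE.unique hex.choose_spec h

theorem exists_mem_polyhedronGraph (hE : HasTransform E) {f : E → ℝ}
    (hf : f ∈ polyhedralFunctions E) : ∃ F, (f, F) ∈ polyhedronGraph E := by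
  induction hf using Submodule.span_induction with
  | mem g hg =>
    obtain ⟨P, hP, rfl⟩ := hg
    obtain ⟨F, hF, -⟩ := hE.1 P hP
    exact ⟨F, Submodule.subset_span ⟨P, hP, rfl, hF⟩⟩
  | zero => exact ⟨0, Submodule.zero_mem _⟩
  | add f g _ _ hf hg =>
    obtain ⟨F, hF⟩ := hf
    obtain ⟨G, hG⟩ := hg
    exact ⟨F + G, Submodule.add_mem _ hF hG⟩
  | smul c f _ hf =>
    obtain ⟨F, hF⟩ := hf
    exact ⟨c • F, Submodule.smul_mem _ c hF⟩

theorem fourierLaplace_mem (hE : HasTransform E) {f : E → ℝ} (hf : AEPolyhedral f) :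
    (f, fourierLaplace f) ∈ transformGraph E := by
  obtain ⟨g, hg, hfg⟩ := hf
  obtain ⟨F, hF⟩ := hE.exists_mem_polyhedronGraph hg
  have h1 : (f - g, (0 : MeromorphicFunctions E)) ∈ transformGraph E :=
    null_mem_transformGraph (by
      filter_upwards [hfg] with x hx
      rw [Pi.sub_apply, hx, sub_self])
  have h2 := Submodule.add_mem _ (polyhedronGraph_le hF) h1
  rw [Prod.mk_add_mk, add_sub_cancel, add_zero] at h2
  rwa [hE.fourierLaplace_eq h2]

theorem fourierLaplace_add (hE : HasTransform E) {f g : E → ℝ} (hf : AEPolyhedral f)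
    (hg : AEPolyhedral g) : fourierLaplace (f + g) = fourierLaplace f + fourierLaplace g :=
  hE.fourierLaplace_eq (Submodule.add_mem _ (hE.fourierLaplace_mem hf) (hE.fourierLaplace_mem hg))

theorem fourierLaplace_smul (hE : HasTransform E) {f : E → ℝ} (hf : AEPolyhedral f) (c : ℝ) :
    fourierLaplace (c • f) = realConst c * fourierLaplace f := by
  rw [← real_smul_eq_ofEntire_mul]
  exact hE.fourierLaplace_eq (Submodule.smul_mem _ c (hE.fourierLaplace_mem hf))

theorem fourierLaplace_eq_zero (hE : HasTransform E) {f : E → ℝ}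
    (hf : f =ᵐ[volume] fun _ => (0 : ℝ)) : fourierLaplace f = 0 :=
  hE.fourierLaplace_eq (null_mem_transformGraph hf)

theorem fourierLaplace_congr (hE : HasTransform E) {f g : E → ℝ} (hg : AEPolyhedral g)
    (hfg : f =ᵐ[volume] g) : fourierLaplace f = fourierLaplace g := by
  have h1 : (f - g, (0 : MeromorphicFunctions E)) ∈ transformGraph E :=
    null_mem_transformGraph (by
      filter_upwards [hfg] with x hx
      rw [Pi.sub_apply, hx, sub_self])
  have h2 := Submodule.add_mem _ (hE.fourierLaplace_mem hg) h1
  rw [Prod.mk_add_mk, add_sub_cancel, add_zero] at h2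
  exact hE.fourierLaplace_eq h2

theorem isPolyhedronTransform (hE : HasTransform E) {P : Set E} (hP : IsPolyhedron P) :
    IsPolyhedronTransform P (fourierLaplace (indicatorFn P)) := by
  obtain ⟨F, hF, -⟩ := hE.1 P hP
  have h : (indicatorFn P, F) ∈ polyhedronGraph E := Submodule.subset_span ⟨P, hP, rfl, hF⟩
  rwa [hE.fourierLaplace_eq (polyhedronGraph_le h)]

theorem isBoundedOnFibers (hE : HasTransform E) {f : E → ℝ} (hf : AEPolyhedral f) :
    IsBoundedOnFibers (fourierLaplace f) := by
  obtain ⟨g, hg, -⟩ := exists_of_mem_transformGraph (hE.fourierLaplace_mem hf)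
  have key : ∀ x ∈ polyhedronGraph E, IsBoundedOnFibers x.2 := by
    intro x hx
    induction hx using Submodule.span_induction with
    | mem x hx =>
      obtain ⟨P, hP, -, h1⟩ := hx
      obtain ⟨F, hF, hF'⟩ := hE.1 P hP
      rwa [h1.unique hP hF]
    | zero => exact IsBoundedOnFibers.zero
    | add x y _ _ hx hy => exact hx.add hy
    | smul c x _ hx => exact hx.real_smul c
  exact key _ hg

end HasTransform

theorem aePolyhedral_signedSection {f : E → ℝ} (hf : f ∈ polyhedralFunctions E)
    (h : OrientedHyperplane E) : AEPolyhedral (signedSection f h) := by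
  induction hf using Submodule.span_induction with
  | mem g hg =>
    obtain ⟨P, hP, rfl⟩ := hg
    obtain ⟨s, rfl⟩ := hP
    obtain ⟨κ, -, hκ⟩ := signedSection_polyhedron h s
    exact ⟨_, Submodule.smul_mem _ κ (indicatorFn_mem (h.isPolyhedron_preimage_param ⟨s, rfl⟩)), hκ⟩
  | zero =>
    refine ⟨0, Submodule.zero_mem _, ?_⟩
    exact signedSection_ae_zero (Submodule.zero_mem _) EventuallyEq.rfl h
  | add f g hf hg ihf ihg =>
    obtain ⟨f', hf', e1⟩ := ihf
    obtain ⟨g', hg', e2⟩ := ihg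
    exact ⟨f' + g', Submodule.add_mem _ hf' hg', (signedSection_add hf hg h).trans (e1.add e2)⟩
  | smul c f hf ihf =>
    obtain ⟨f', hf', e1⟩ := ihf
    exact ⟨c • f', Submodule.smul_mem _ c hf', (signedSection_smul hf c h).trans (e1.const_smul c)⟩

/-- The expression of the transform of `f` by the transforms of its sections by the hyperplanes of
`H`, which comes from integration by parts in the direction `v`. -/
noncomputable def stokesSum (v : E) (H : Finset (OrientedHyperplane E)) (f : E → ℝ) :
    MeromorphicFunctions E :=
  (ofEntire (linForm v))⁻¹ * ∑ h ∈ H, realConst (-⟪h.normal, v⟫) *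
    (ofEntire (expForm (h.offset • h.normal)) * pullback h.Space (fourierLaplace (signedSection f h)))

theorem stokesSum_add
    (hS : ∀ h : OrientedHyperplane E, HasTransform h.Space)
    (v : E) (H : Finset (OrientedHyperplane E)) {f g : E → ℝ}
    (hf : f ∈ polyhedralFunctions E) (hg : g ∈ polyhedralFunctions E) :
    stokesSum v H (f + g) = stokesSum v H f + stokesSum v H g := by
  rw [stokesSum, stokesSum, stokesSum, ← mul_add, ← Finset.sum_add_distrib]
  congr 1
  refine Finset.sum_congr rfl fun h _ => ?_
  have hp : AEPolyhedral (signedSection f h + signedSection g h) := by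
    obtain ⟨f', hf', e1⟩ := aePolyhedral_signedSection hf h
    obtain ⟨g', hg', e2⟩ := aePolyhedral_signedSection hg h
    exact ⟨f' + g', Submodule.add_mem _ hf' hg', e1.add e2⟩
  rw [(hS h).fourierLaplace_congr hp (signedSection_add hf hg h),
    (hS h).fourierLaplace_add (aePolyhedral_signedSection hf h) (aePolyhedral_signedSection hg h),
    RingHom.map_add, mul_add, mul_add]

theorem stokesSum_smul
    (hS : ∀ h : OrientedHyperplane E, HasTransform h.Space)
    (v : E) (H : Finset (OrientedHyperplane E)) {f : E → ℝ}
    (hf : f ∈ polyhedralFunctions E) (c : ℝ) :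
    stokesSum v H (c • f) = realConst c * stokesSum v H f := by
  unfold stokesSum
  refine Eq.trans ?_ (mul_left_comm _ _ _)
  congr 1
  refine Eq.trans ?_ (Finset.mul_sum _ _ _).symm
  refine Finset.sum_congr rfl fun h _ => ?_
  have hp : AEPolyhedral (c • signedSection f h) := by
    obtain ⟨f', hf', e1⟩ := aePolyhedral_signedSection hf h
    exact ⟨c • f', Submodule.smul_mem _ c hf', e1.const_smul c⟩
  rw [(hS h).fourierLaplace_congr hp (signedSection_smul hf c h),
    (hS h).fourierLaplace_smul (aePolyhedral_signedSection hf h), RingHom.map_mul,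
    pullback_ofEntire]
  have : ofEntire (pullbackEntire h.Space (algebraMap ℂ (entireFunctions h.Space) (c : ℂ))) =
    realConst (E := E) c := rfl
  rw [this]
  ring

theorem stokesSum_eq_zero (v : E) (H : Finset (OrientedHyperplane E)) {f : E → ℝ}
    (hf : ∀ h ∈ H, fourierLaplace (signedSection f h) = 0) : stokesSum v H f = 0 := by
  rw [stokesSum, Finset.sum_eq_zero, mul_zero]
  intro h hh
  rw [hf h hh, map_zero, mul_zero, mul_zero]

/-- The factor `1 / z(v)` is kept apart from the bounded one, since it is the source of decay in the
vanishing argument. -/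
theorem exists_stokesSum_eq_inv_linForm_mul
    (hS : ∀ h : OrientedHyperplane E, HasTransform h.Space)
    (v : E) (H : Finset (OrientedHyperplane E)) {f : E → ℝ} (hf : f ∈ polyhedralFunctions E) :
    ∃ S, IsBoundedOnFibers S ∧ stokesSum v H f = (ofEntire (linForm v))⁻¹ * S :=
  ⟨_, IsBoundedOnFibers.sum H fun h _ =>
    (IsBoundedOnFibers.const _).mul ((IsBoundedOnFibers.expForm _).mul
      ((hS h).isBoundedOnFibers (aePolyhedral_signedSection hf h)).pullback), rfl⟩

theorem isBoundedOnFibers_stokesSum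
    (hS : ∀ h : OrientedHyperplane E, HasTransform h.Space)
    {v : E} (hv : v ≠ 0) (H : Finset (OrientedHyperplane E))
    {f : E → ℝ} (hf : f ∈ polyhedralFunctions E) : IsBoundedOnFibers (stokesSum v H f) := by
  obtain ⟨S, hS', h⟩ := exists_stokesSum_eq_inv_linForm_mul hS v H hf
  rw [h]
  exact (IsBoundedOnFibers.inv_linForm hv).mul hS'

/-- If the line is parallel to `h`, the section is a multiple of the indicator of a polyhedron that
is empty or contains a line. If it is transverse to `h`, the polyhedron is invariant along it and
there is no jump. -/
theorem fourierLaplace_signedSection_eq_zero_of_containsLine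
    (hS : ∀ h : OrientedHyperplane E, HasTransform h.Space)
    {P : Set E} (hP : IsPolyhedron P)
    (hl : ContainsLine P) (h : OrientedHyperplane E) :
    fourierLaplace (signedSection (indicatorFn P) h) = 0 := by
  obtain ⟨s, rfl⟩ := hP
  obtain ⟨-, w, hw, hsw⟩ := (containsLine_iff s).1 hl
  obtain ⟨κ, hκ, hsec⟩ := signedSection_polyhedron h s
  by_cases hn : ⟪h.normal, w⟫ = 0
  · have hPh := h.isPolyhedron_preimage_param (P := {x | ∀ ab ∈ s, ⟪ab.1, x⟫ ≤ ab.2}) ⟨s, rfl⟩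
    have hpoly := indicatorFn_mem hPh
    rw [(hS h).fourierLaplace_congr (.of_mem (Submodule.smul_mem _ κ hpoly)) hsec,
      (hS h).fourierLaplace_smul (.of_mem hpoly)]
    rcases Set.eq_empty_or_nonempty (h.param ⁻¹' {x | ∀ ab ∈ s, ⟪ab.1, x⟫ ≤ ab.2}) with h0 | ⟨y, hy⟩
    · rw [h0, (hS h).fourierLaplace_eq_zero (by simp [indicatorFn]), mul_zero]
    · have hl' : ContainsLine (h.param ⁻¹' {x | ∀ ab ∈ s, ⟪ab.1, x⟫ ≤ ab.2}) := by
        refine ⟨y, ⟨w, Submodule.mem_orthogonal_singleton_iff_inner_right.2 hn⟩,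
          fun h0 => hw (congrArg Subtype.val h0), fun t => ?_⟩
        rw [Set.mem_preimage, h.param_add_smul]
        intro ab hab
        rw [inner_add_right, inner_smul_right, hsw ab hab, mul_zero, add_zero]
        exact hy ab hab
      rcases (hS h).isPolyhedronTransform hPh with h1 | h1
      · rw [h1.2, mul_zero]
      · exact absurd hl' h1.1
  · rw [hκ w hsw hn, zero_smul] at hsec
    exact (hS h).fourierLaplace_eq_zero hsec

theorem represents_fourierLaplace_signedSection
    (hS : ∀ h : OrientedHyperplane E, HasTransform h.Space)
    {P : Set E} (hP : IsPolyhedron P)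
    (hl : ¬ ContainsLine P) (h : OrientedHyperplane E) :
    Represents (fourierLaplace (signedSection (indicatorFn P) h)) (decayFreq (h.param ⁻¹' P))
      fun z => ∫ y, (signedSection (indicatorFn P) h y : ℂ) * Complex.exp (z y) := by
  have hPh := h.isPolyhedron_preimage_param hP
  have hm := (isClosed_polyhedron hPh).measurableSet
  have hpoly := indicatorFn_mem hPh
  obtain ⟨κ, hsec⟩ : ∃ κ : ℝ, signedSection (indicatorFn P) h =ᵐ[volume]
      κ • indicatorFn (h.param ⁻¹' P) := by
    obtain ⟨s, rfl⟩ := hP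
    obtain ⟨κ, -, hsec⟩ := signedSection_polyhedron h s
    exact ⟨κ, hsec⟩
  rw [(hS h).fourierLaplace_congr (.of_mem (Submodule.smul_mem _ κ hpoly)) hsec,
    (hS h).fourierLaplace_smul (.of_mem hpoly)]
  have h1 : Represents (fourierLaplace (indicatorFn (h.param ⁻¹' P)))
      {z | IntegrableOn (fun x => Complex.exp (z x)) (h.param ⁻¹' P)}
      fun z => ∫ x in h.param ⁻¹' P, Complex.exp (z x) := by
    rcases (hS h).isPolyhedronTransform hPh with h1 | h1
    · exact absurd h1.1.of_preimage_param hl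
    · exact h1.2
  refine ((Represents.of_entire _).mul h1).mono
    (fun z hz => integrableOn_exp_of_mem_decayFreq hm hz) fun z _ => ?_
  change _ = (κ : ℂ) * _
  rw [← integral_indicatorFn_mul hm, ← integral_const_mul]
  refine integral_congr_ae ?_
  filter_upwards [hsec] with y hy
  rw [hy, Pi.smul_apply, smul_eq_mul, Complex.ofReal_mul, mul_assoc]

/-- For a polyhedron without lines, integration by parts gives the formula where the exponential
decays, and `Represents.of_decayFreq` extends it. With a line, every section transforms to 0. -/
theorem isPolyhedronTransform_stokesSum
    (hS : ∀ h : OrientedHyperplane E, HasTransform h.Space)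
    {s : Finset (E × ℝ)} {v : E} (hv : v ≠ 0)
    {H : Finset (OrientedHyperplane E)} (hH : ∀ h ∈ H, 0 < ⟪h.normal, v⟫)
    (hc : CoversConstraints H s) :
    IsPolyhedronTransform {x | ∀ ab ∈ s, ⟪ab.1, x⟫ ≤ ab.2}
      (stokesSum v H (indicatorFn {x | ∀ ab ∈ s, ⟪ab.1, x⟫ ≤ ab.2})) := by
  have hcov := hc.coversJumps hH
  have hP : IsPolyhedron {x : E | ∀ ab ∈ s, ⟪ab.1, x⟫ ≤ ab.2} := ⟨s, rfl⟩
  generalize {x : E | ∀ ab ∈ s, ⟪ab.1, x⟫ ≤ ab.2} = P at hP hcov ⊢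
  by_cases hl : ContainsLine P
  · exact Or.inl ⟨hl, stokesSum_eq_zero v H fun h _ =>
      fourierLaplace_signedSection_eq_zero_of_containsLine hS hP hl h⟩
  refine Or.inr ⟨hl, Represents.of_decayFreq hP (decayFreq_nonempty_of_not_containsLine hP hl) ?_⟩
  have hterm : ∀ h ∈ H, Represents (realConst (-⟪h.normal, v⟫) *
      (ofEntire (expForm (h.offset • h.normal)) *
        pullback h.Space (fourierLaplace (signedSection (indicatorFn P) h)))) (decayFreq P)
      fun z => ((-⟪h.normal, v⟫ : ℝ) : ℂ) * (Complex.exp (z (h.offset • h.normal)) *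
        ∫ y : h.Space, (signedSection (indicatorFn P) h y : ℂ) * Complex.exp (z y)) :=
    fun h _ => (Represents.of_entire _).mul ((Represents.of_entire _).mul
      ((represents_fourierLaplace_signedSection hS hP hl h).pullback.mono
        (fun z hz => restrictFreq_mem_decayFreq hz h) fun _ _ => rfl))
  refine Represents.inv_linForm_mul hv ((Represents.sum H hterm).mono subset_rfl ?_)
  intro z hz
  obtain ⟨δ, hδ, C, hC⟩ := hz
  have hst := integral_stokes (indicatorFn_mem hP) z hδ (norm_indicatorFn_mul_exp_le hC) hH hcov
  rw [integral_indicatorFn_mul (isClosed_polyhedron hP).measurableSet] at hst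
  rw [hst, ← Finset.sum_neg_distrib]
  refine Finset.sum_congr rfl fun h _ => ?_
  rw [← integral_const_mul, ← integral_const_mul, ← integral_const_mul, ← integral_neg]
  refine integral_congr_ae (Eventually.of_forall fun y => ?_)
  change -(((⟪h.normal, v⟫ : ℝ) : ℂ) * ((signedSection (indicatorFn P) h y : ℂ) *
    Complex.exp (z (h.param y)))) = _
  rw [OrientedHyperplane.param, map_add, Complex.exp_add, Complex.ofReal_neg]
  ring

/-- The heart of well-definedness: `x.2` is expressed through the function `x.1` alone. The set `s`
collects the constraints of all polyhedra in some decomposition of `x`, and the formula holds for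
every transverse `v` and every family covering `s`. -/
theorem exists_eq_stokesSum
    (hS : ∀ h : OrientedHyperplane E, HasTransform h.Space)
    {x : (E → ℝ) × MeromorphicFunctions E} (hx : x ∈ polyhedronGraph E) :
    ∃ s : Finset (E × ℝ), ∀ v : E, v ≠ 0 → ∀ H : Finset (OrientedHyperplane E),
      (∀ h ∈ H, 0 < ⟪h.normal, v⟫) → CoversConstraints H s → x.2 = stokesSum v H x.1 := by
  classical
  induction hx using Submodule.span_induction with
  | mem x hx =>
    obtain ⟨P, ⟨s, hs⟩, h1, h2⟩ := hx
    refine ⟨s, fun v hv H hH hc => ?_⟩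
    rw [h1]
    refine h2.unique ⟨s, hs⟩ ?_
    rw [hs]
    exact isPolyhedronTransform_stokesSum hS hv hH hc
  | zero =>
    refine ⟨∅, fun v _ H _ _ => (stokesSum_eq_zero v H fun h _ => ?_).symm⟩
    exact (hS h).fourierLaplace_eq_zero
      (signedSection_ae_zero (Submodule.zero_mem _) EventuallyEq.rfl h)
  | add x y hx hy ihx ihy =>
    obtain ⟨s, hs⟩ := ihx
    obtain ⟨t, ht⟩ := ihy
    refine ⟨s ∪ t, fun v hv H hH hc => ?_⟩
    rw [Prod.fst_add, stokesSum_add hS v H (fst_mem_of_mem_polyhedronGraph hx)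
      (fst_mem_of_mem_polyhedronGraph hy),
      ← hs v hv H hH (hc.mono subset_rfl Finset.subset_union_left),
      ← ht v hv H hH (hc.mono subset_rfl Finset.subset_union_right)]
    rfl
  | smul c x hx ihx =>
    obtain ⟨s, hs⟩ := ihx
    refine ⟨s, fun v hv H hH hc => ?_⟩
    rw [Prod.smul_fst, stokesSum_smul hS v H (fst_mem_of_mem_polyhedronGraph hx),
      ← hs v hv H hH hc, ← real_smul_eq_ofEntire_mul]
    rfl

/-- A function that is zero almost everywhere has sections of zero transform, so
`exists_eq_stokesSum` forces its transform to be 0. -/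
theorem HasTransform.of_sections [Nontrivial E]
    (hS : ∀ h : OrientedHyperplane E, HasTransform h.Space) : HasTransform E := by
  obtain ⟨a₀, ha₀⟩ := exists_ne (0 : E)
  constructor
  · rintro P ⟨s, rfl⟩
    obtain ⟨v, hv, -, H, hH, hc⟩ := exists_direction s a₀ ha₀
    exact ⟨_, isPolyhedronTransform_stokesSum hS hv hH hc,
      isBoundedOnFibers_stokesSum hS hv H (indicatorFn_mem ⟨s, rfl⟩)⟩
  · intro F hF
    obtain ⟨g, hg, h0⟩ := exists_of_mem_transformGraph hF
    obtain ⟨s, hs⟩ := exists_eq_stokesSum hS hg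
    obtain ⟨v, hv, -, H, hH, hc⟩ := exists_direction s a₀ ha₀
    refine (hs v hv H hH hc).trans (stokesSum_eq_zero v H fun h _ => ?_)
    exact (hS h).fourierLaplace_eq_zero
      (signedSection_ae_zero (fst_mem_of_mem_polyhedronGraph hg) h0.symm h)

/-- On a point the transform is evaluation times the mass `m` of the point. The measure is nonzero,
so equality almost everywhere is equality. -/
theorem HasTransform.of_subsingleton [Subsingleton E] : HasTransform E := by
  have hz : ∀ (z : E →L[ℝ] ℂ) (x : E), z x = 0 := fun z x => by
    rw [Subsingleton.elim x 0, map_zero]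
  set m := (volume : Measure E).real Set.univ
  have hm : m ≠ 0 := by
    have h1 : (volume : Measure E) Set.univ ≠ 0 := (isOpen_univ.measure_pos _ ⟨0, trivial⟩).ne'
    have h2 : (volume : Measure E) Set.univ ≠ ⊤ := by
      have : (Set.univ : Set E) = Metric.ball 0 1 := by
        ext x
        simp [Subsingleton.elim x 0]
      rw [this]
      exact measure_ball_lt_top.ne
    exact (ENNReal.toReal_pos h1 h2).ne'
  have hint : ∀ (P : Set E) (z : E →L[ℝ] ℂ),
      ∫ x in P, Complex.exp (z x) = ((m * indicatorFn P 0 : ℝ) : ℂ) := by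
    intro P z
    simp only [hz, Complex.exp_zero]
    rcases Set.eq_empty_or_nonempty P with rfl | ⟨x, hx⟩
    · simp [indicatorFn]
    · have : P = Set.univ := Set.eq_univ_of_forall fun y => by rwa [Subsingleton.elim y x]
      rw [this]
      simp [indicatorFn, m]
  have hline : ∀ P : Set E, ¬ ContainsLine P := fun P ⟨_, w, hw, _⟩ => hw (Subsingleton.elim _ _)
  have htr : ∀ P : Set E, IsPolyhedronTransform P (realConst (m * indicatorFn P 0)) := fun P =>
    Or.inr ⟨hline P, algebraMap ℂ _ ((m * indicatorFn P 0 : ℝ) : ℂ), 1, one_ne_zero,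
      by simp [realConst, ofEntire], fun z _ => by rw [hint]; exact one_mul _⟩
  refine ⟨fun P _ => ⟨_, htr P, IsBoundedOnFibers.const _⟩, fun F hF => ?_⟩
  obtain ⟨g, hg, h0⟩ := exists_of_mem_transformGraph hF
  have key : ∀ x ∈ polyhedronGraph E, x.2 = realConst (m * x.1 0) := by
    intro x hx
    induction hx using Submodule.span_induction with
    | mem x hx =>
      obtain ⟨P, hP, h1, h2⟩ := hx
      rw [h1]
      exact h2.unique hP (htr P)
    | zero => simp [realConst, ofEntire]
    | add x y _ _ hx hy =>
      rw [Prod.snd_add, hx, hy, Prod.fst_add, Pi.add_apply, mul_add]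
      simp only [realConst, ofEntire, Complex.ofReal_add, map_add]
    | smul c x _ hx =>
      rw [Prod.smul_snd, hx, Prod.smul_fst, Pi.smul_apply, smul_eq_mul, real_smul_eq_ofEntire_mul,
        mul_left_comm]
      simp only [realConst, ofEntire, Complex.ofReal_mul, map_mul]
  have hg0 : g 0 = 0 := by
    have : (ae (volume : Measure E)).NeBot := ae_neBot.2 (NeZero.ne _)
    obtain ⟨x, hx⟩ := h0.exists
    rw [Subsingleton.elim (0 : E) x, ← hx]
    rfl
  refine (key _ hg).trans ?_
  change realConst (m * g 0) = 0
  rw [hg0, mul_zero]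
  simp [realConst, ofEntire]

theorem hasTransform_of_finrank_eq (n : ℕ) : ∀ (E : Type*) [NormedAddCommGroup E]
    [InnerProductSpace ℝ E] [FiniteDimensional ℝ E] [MeasurableSpace E] [BorelSpace E],
    Module.finrank ℝ E = n → HasTransform E := by
  induction n with
  | zero =>
    intro E _ _ _ _ _ hE
    have := Module.finrank_zero_iff.1 hE
    exact HasTransform.of_subsingleton
  | succ n ih =>
    intro E _ _ _ _ _ hE
    have : Nontrivial E := Module.nontrivial_of_finrank_eq_succ hE
    have : Fact (Module.finrank ℝ E = n + 1) := ⟨hE⟩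
    exact HasTransform.of_sections fun h =>
      ih h.Space (Submodule.finrank_orthogonal_span_singleton h.normal_ne_zero)

variable (E) in
theorem hasTransform : HasTransform E := hasTransform_of_finrank_eq _ E rfl

/-- The transform of a polyhedral function is determined by the transforms of its sections. -/
theorem exists_fourierLaplace_eq_stokesSum {f : E → ℝ} (hf : f ∈ polyhedralFunctions E) :
    ∃ s : Finset (E × ℝ), ∀ v : E, v ≠ 0 → ∀ H : Finset (OrientedHyperplane E),
      (∀ h ∈ H, 0 < ⟪h.normal, v⟫) → CoversConstraints H s → fourierLaplace f = stokesSum v H f := by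
  obtain ⟨F, hF⟩ := (hasTransform E).exists_mem_polyhedronGraph hf
  rw [(hasTransform E).fourierLaplace_eq (polyhedronGraph_le hF)]
  exact exists_eq_stokesSum (fun h => hasTransform h.Space) hF

end Transform

/-! ### Exponential sums that tend to zero. -/

section ExponentialSums

/-- An exponential sum with distinct frequencies which tends to zero has zero coefficients. -/
theorem eq_zero_of_tendsto_sum_exp {ι : Type*} (s : Finset ι) {c : ι → ℝ}
    (hc : Set.InjOn c s) : ∀ {A : ι → ℂ},
    Tendsto (fun t : ℝ => ∑ i ∈ s, A i * Complex.exp (Complex.I * (t * c i : ℝ))) atTop (𝓝 0) →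
      ∀ i ∈ s, A i = 0 := by
  classical
  induction s using Finset.induction_on with
  | empty => simp
  | insert a s ha ih =>
    intro A hA
    have hs : ∀ i ∈ s, A i = 0 := by
      intro i hi
      have hne : c i - c a ≠ 0 := sub_ne_zero.2 fun h => ha
        (hc (Finset.mem_coe.2 (Finset.mem_insert_of_mem hi))
          (Finset.mem_coe.2 (Finset.mem_insert_self a s)) h ▸ hi)
      -- With this shift, `exp (i δ c_i)` is the negative of `exp (i δ c_a)`, so the new coefficient
      -- at `i` is a nonzero multiple of `A i`.
      set δ := Real.pi / (c i - c a)
      -- For the sum S, the combination S(t + δ) - e^{iδ c_a} S(t) kills the term `a` and still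
      -- tends to 0, so the induction hypothesis applies.
      have h1 : Tendsto (fun t : ℝ => ∑ j ∈ s,
          A j * (Complex.exp (Complex.I * (δ * c j : ℝ)) -
            Complex.exp (Complex.I * (δ * c a : ℝ))) * Complex.exp (Complex.I * (t * c j : ℝ)))
          atTop (𝓝 0) := by
        have h2 := (hA.comp (tendsto_atTop_add_const_right atTop δ tendsto_id)).sub
          (hA.const_mul (Complex.exp (Complex.I * (δ * c a : ℝ))))
        rw [mul_zero, sub_zero] at h2
        refine h2.congr fun t => ?_
        simp only [Function.comp_apply, id]
        rw [Finset.mul_sum, ← Finset.sum_sub_distrib, Finset.sum_insert ha]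
        have h3 : ∀ j, Complex.exp (Complex.I * ((t + δ) * c j : ℝ)) =
            Complex.exp (Complex.I * (t * c j : ℝ)) * Complex.exp (Complex.I * (δ * c j : ℝ)) := by
          intro j
          rw [← Complex.exp_add]
          congr 1
          push_cast
          ring
        simp only [h3]
        rw [show ∀ x y : ℂ, x = 0 → x + y = y from fun x y h => by rw [h, zero_add]]
        · exact Finset.sum_congr rfl fun j _ => by ring
        · ring
      have h4 := ih (hc.mono (Finset.coe_subset.2 (Finset.subset_insert a s))) h1 i hi
      refine (mul_eq_zero.1 h4).resolve_right fun h5 => ?_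
      have h6 : Complex.exp (Complex.I * (δ * c i : ℝ)) =
          -Complex.exp (Complex.I * (δ * c a : ℝ)) := by
        have h7 : δ * c i = Real.pi + δ * c a := by
          simp only [δ]
          field_simp
          ring
        rw [h7, Complex.ofReal_add, mul_add, Complex.exp_add, mul_comm Complex.I (Real.pi : ℂ),
          Complex.exp_pi_mul_I, neg_one_mul]
      rw [h6, ← neg_add', neg_eq_zero, ← two_mul] at h5
      exact (mul_ne_zero two_ne_zero (Complex.exp_ne_zero _)) h5
    intro i hi
    rcases Finset.mem_insert.1 hi with rfl | hi
    · have h1 : ∀ t : ℝ, ‖∑ j ∈ insert i s, A j * Complex.exp (Complex.I * (t * c j : ℝ))‖ =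
          ‖A i‖ := by
        intro t
        rw [Finset.sum_insert ha, Finset.sum_eq_zero fun j hj => by rw [hs j hj, zero_mul],
          add_zero, norm_mul, Complex.norm_exp_I_mul_ofReal, mul_one]
      have h2 := hA.norm
      simp only [h1, norm_zero] at h2
      exact norm_eq_zero.1 (tendsto_nhds_unique tendsto_const_nhds h2)
    · exact hs i hi

theorem tendsto_inv_add_I_mul (w : ℂ) {r : ℝ} (hr : r ≠ 0) :
    Tendsto (fun t : ℝ => (w + Complex.I * (t * r : ℝ))⁻¹) atTop (𝓝 0) := by
  refine tendsto_inv₀_cobounded.comp ?_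
  refine tendsto_norm_atTop_iff_cobounded.1 ?_
  refine tendsto_atTop_mono (f := fun t : ℝ => t * |r| - ‖w‖) (fun t => ?_) ?_
  · have h1 : ‖Complex.I * (t * r : ℝ)‖ = |t| * |r| := by
      rw [norm_mul, Complex.norm_I, one_mul, Complex.norm_real, Real.norm_eq_abs, abs_mul]
    have h2 := norm_sub_le (w + Complex.I * (t * r : ℝ)) w
    rw [add_sub_cancel_left, h1] at h2
    have h3 := mul_le_mul_of_nonneg_right (le_abs_self t) (abs_nonneg r)
    linarith
  · exact tendsto_atTop_add_const_right _ _
      (tendsto_id.atTop_mul_const (abs_pos.2 hr))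

end ExponentialSums

/-! ### Restriction of imaginary shifts to hyperplanes. -/

section Restriction

variable {E : Type*} [NormedAddCommGroup E] [InnerProductSpace ℝ E]

/-- The vector `a` is the orthogonal projection of `n`; an imaginary shift along `n` restricts on
`h` to the shift along `a`. -/
theorem OrientedHyperplane.exists_inner_eq_inner [FiniteDimensional ℝ E] (h : OrientedHyperplane E) (n : E) :
    ∃ a : h.Space, ∀ y : h.Space, ⟪a, y⟫ = ⟪n, (y : E)⟫ := by
  refine ⟨(InnerProductSpace.toDual ℝ h.Space).symm ((innerSL ℝ n).comp h.Space.subtypeL),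
    fun y => ?_⟩
  rw [InnerProductSpace.toDual_symm_apply]
  rfl

theorem restrictFreq_add_imagFreq {K : Submodule ℝ E} {n : E} {a : K}
    (ha : ∀ y : K, ⟪a, y⟫ = ⟪n, (y : E)⟫) (z : E →L[ℝ] ℂ) (t : ℝ) :
    restrictFreq K (z + imagFreq (t • innerSL ℝ n)) =
      restrictFreq K z + imagFreq (t • innerSL ℝ a) := by
  ext y
  simp only [restrictFreq_apply, add_apply, imagFreq_apply,
    smul_apply, innerSL_apply_apply]
  rw [ha y]

theorem OrientedHyperplane.normal_eq_of_inner_eq_zero {h h' : OrientedHyperplane E} {v : E}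
    (hv : 0 < ⟪h.normal, v⟫) (hv' : 0 < ⟪h'.normal, v⟫)
    (h0 : ∀ y : h.Space, ⟪h'.normal, (y : E)⟫ = 0) : h'.normal = h.normal := by
  have h1 : h'.normal ∈ h.Spaceᗮ :=
    (Submodule.mem_orthogonal' _ _).2 fun y hy => h0 ⟨y, hy⟩
  rw [OrientedHyperplane.Space, Submodule.orthogonal_orthogonal] at h1
  obtain ⟨μ, hμ⟩ := Submodule.mem_span_singleton.1 h1
  exact OrientedHyperplane.eq_of_normal_eq_smul hv hv' hμ.symm

end Restriction

/-! ### Vanishing of the sections of a function with zero transform, and the converse. -/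

section Vanishing

variable {E : Type*} [NormedAddCommGroup E] [InnerProductSpace ℝ E]
  [FiniteDimensional ℝ E] [MeasurableSpace E] [BorelSpace E]

/-- The Stokes formula with `⟪a, v⟫ > 0` writes the transform as `1 / z(v)` times a function bounded
along imaginary shifts, and the first factor tends to 0 along `z + i t a`. -/
theorem exists_boundedRep_tendsto_zero {f : E → ℝ} (hf : AEPolyhedral f) {a : E} (ha : a ≠ 0) :
    ∃ U : Finset E, (0 : E) ∉ U ∧ ∃ φ, BoundedRep U (fourierLaplace f) φ ∧
      ∀ z ∈ genericFreq U,
        Tendsto (fun t : ℝ => φ (z + imagFreq (t • innerSL ℝ a))) atTop (𝓝 0) := by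
  classical
  obtain ⟨g, hg, hfg⟩ := hf
  obtain ⟨s, hs⟩ := exists_fourierLaplace_eq_stokesSum hg
  obtain ⟨v, hv, hav, H, hH, hc⟩ := exists_direction s a ha
  obtain ⟨S, ⟨U, hU, ψ, hψ⟩, hSeq⟩ :=
    exists_stokesSum_eq_inv_linForm_mul (fun h => hasTransform h.Space) v H hg
  rw [(hasTransform E).fourierLaplace_congr (.of_mem hg) hfg, hs v hv H hH hc, hSeq]
  have hψ' := hψ.mono (Finset.subset_insert v U)
  refine ⟨insert v U, by simp [hU, hv.symm], _,
    ((BoundedRep.inv_linForm hv).mono (by simp)).mul hψ', fun z hz => ?_⟩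
  obtain ⟨C, hC⟩ := hψ'.2 z hz
  have h1 : Tendsto (fun t : ℝ => ((z + imagFreq (t • innerSL ℝ a)) v)⁻¹) atTop (𝓝 0) :=
    tendsto_inv_add_I_mul (z v) hav.ne'
  exact h1.zero_mul_isBoundedUnder_le (isBoundedUnder_of ⟨C, fun t => hC _⟩)

theorem fourierLaplace_signedSection_eq_zero {f : E → ℝ} (hf : f ∈ polyhedralFunctions E)
    (hf0 : fourierLaplace f = 0) (h₀ : OrientedHyperplane E) :
    fourierLaplace (signedSection f h₀) = 0 := by
  classical
  obtain ⟨s, hs⟩ := exists_fourierLaplace_eq_stokesSum hf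
  obtain ⟨v, hv, hnv, H₁, hH₁, hc₁⟩ := exists_direction s h₀.normal h₀.normal_ne_zero
  -- The given hyperplane may be added with its own orientation, since `v` was chosen positive on
  -- its normal; the Stokes formula tolerates superfluous hyperplanes.
  obtain ⟨H, hh₀, hH, hc⟩ : ∃ H : Finset (OrientedHyperplane E), h₀ ∈ H ∧
      (∀ h ∈ H, 0 < ⟪h.normal, v⟫) ∧ CoversConstraints H s :=
    ⟨insert h₀ H₁, Finset.mem_insert_self _ _,
      Finset.forall_mem_insert _ _ _ |>.2 ⟨hnv, hH₁⟩,
      hc₁.mono (Finset.subset_insert _ _) subset_rfl⟩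
  choose a ha using fun h => OrientedHyperplane.exists_inner_eq_inner h h₀.normal
  have hrep : ∀ h : OrientedHyperplane E, ∃ U : Finset h.Space, (0 : h.Space) ∉ U ∧
      ∃ φ, BoundedRep U (fourierLaplace (signedSection f h)) φ ∧ (a h ≠ 0 →
        ∀ z ∈ genericFreq U,
          Tendsto (fun t : ℝ => φ (z + imagFreq (t • innerSL ℝ (a h)))) atTop (𝓝 0)) := by
    intro h
    by_cases h0 : a h = 0
    · obtain ⟨U, hU, φ, hφ⟩ :=
        (hasTransform h.Space).isBoundedOnFibers (aePolyhedral_signedSection hf h)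
      exact ⟨U, hU, φ, hφ, fun h1 => absurd h0 h1⟩
    · obtain ⟨U, hU, φ, hφ, ht⟩ :=
        exists_boundedRep_tendsto_zero (aePolyhedral_signedSection hf h) h0
      exact ⟨U, hU, φ, hφ, fun _ => ht⟩
  choose U hU φ hφ hlim using hrep
  set V : Finset E := H.biUnion fun h => (U h).map (Function.Embedding.subtype _) with hV
  have hV0 : (0 : E) ∉ V := by
    rw [hV, Finset.mem_biUnion]
    rintro ⟨h, -, hm⟩
    obtain ⟨u, hu, hu0⟩ := Finset.mem_map.1 hm
    have : u = 0 := Subtype.ext hu0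
    exact hU h (this ▸ hu)
  have hUV : ∀ h ∈ H, (U h).map (Function.Embedding.subtype _) ⊆ V := fun h hh =>
    Finset.subset_biUnion_of_mem (fun h : OrientedHyperplane E =>
      (U h).map (Function.Embedding.subtype (· ∈ h.Space))) hh
  have hpull : ∀ h ∈ H, BoundedRep V (pullback h.Space (fourierLaplace (signedSection f h)))
      (fun z => φ h (restrictFreq h.Space z)) := fun h hh => (hφ h).pullback.mono (hUV h hh)
  have hsum0 : ∑ h ∈ H, realConst (-⟪h.normal, v⟫) * (ofEntire (expForm (h.offset • h.normal)) *
      pullback h.Space (fourierLaplace (signedSection f h))) = 0 := by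
    have h1 : stokesSum v H f = 0 := (hs v hv H hH hc).symm.trans hf0
    refine (mul_eq_zero.1 h1).resolve_left (inv_ne_zero fun h2 => ?_)
    exact linForm_ne_zero hv (ofEntire_injective (by rw [h2]; exact (map_zero _).symm))
  -- The identity of meromorphic functions becomes an identity of values at each frequency generic
  -- for all terms at once.
  have hsum : ∀ w ∈ genericFreq V, ∑ h ∈ H, ((-⟪h.normal, v⟫ : ℝ) : ℂ) *
      (Complex.exp (w (h.offset • h.normal)) * φ h (restrictFreq h.Space w)) = 0 := by
    have h1 := BoundedRep.sum H fun h hh =>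
      (BoundedRep.const (U := V) ((-⟪h.normal, v⟫ : ℝ) : ℂ)).mul
        ((BoundedRep.expForm (h.offset • h.normal)).mul (hpull h hh))
    rw [hsum0] at h1
    exact h1.eq_zero_of_zero
  refine (pullback h₀.Space).injective ?_
  rw [RingHom.map_zero]
  refine (hpull h₀ hh₀).zero_of_eq_zero hV0 fun z hz => ?_
  -- Since all hyperplanes in `H` are oriented by `v`, being parallel to `h₀` means having the same
  -- normal, and exactly then the projection `a h` vanishes.
  have hne : ∀ h ∈ H, h.normal ≠ h₀.normal → a h ≠ 0 := by
    intro h hh hn h0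
    refine hn (OrientedHyperplane.normal_eq_of_inner_eq_zero (hH h hh) hnv fun y => ?_).symm
    rw [← ha h y, h0, inner_zero_left]
  have heq : ∀ h : OrientedHyperplane E, h.normal = h₀.normal → a h = 0 := by
    intro h hn
    refine ext_inner_right ℝ fun y => ?_
    rw [ha h y, ← hn, h.inner_normal_coe, inner_zero_left]
  have hz' : ∀ h ∈ H, restrictFreq h.Space z ∈ genericFreq (U h) := fun h hh u hu =>
    hz u (hUV h hh (Finset.mem_map.2 ⟨u, hu, rfl⟩))
  -- The identity at `z + i t n₀`, rearranged: the non-parallel terms tend to 0, hence so does the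
  -- sum over the parallel ones, whose only dependence on `t` is through `exp (i t · offset)`.
  have hmain : Tendsto (fun t : ℝ => ∑ h ∈ H with h.normal = h₀.normal,
      (((-⟪h.normal, v⟫ : ℝ) : ℂ) * (Complex.exp (z (h.offset • h.normal)) *
        φ h (restrictFreq h.Space z))) * Complex.exp (Complex.I * (t * h.offset : ℝ)))
      atTop (𝓝 0) := by
    have h1 : Tendsto (fun t : ℝ => -∑ h ∈ H with ¬ h.normal = h₀.normal,
        ((-⟪h.normal, v⟫ : ℝ) : ℂ) *
          (Complex.exp ((z + imagFreq (t • innerSL ℝ h₀.normal)) (h.offset • h.normal)) *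
            φ h (restrictFreq h.Space z + imagFreq (t • innerSL ℝ (a h))))) atTop (𝓝 0) := by
      rw [← neg_zero]
      refine Tendsto.neg ?_
      rw [← Finset.sum_const_zero (s := H.filter fun h => ¬ h.normal = h₀.normal)]
      refine tendsto_finsetSum _ fun h hh => ?_
      obtain ⟨hh, hn⟩ := Finset.mem_filter.1 hh
      have h2 := hlim h (hne h hh hn) _ (hz' h hh)
      have h3 : IsBoundedUnder (· ≤ ·) atTop ((‖·‖) ∘ fun t : ℝ =>
          Complex.exp ((z + imagFreq (t • innerSL ℝ h₀.normal)) (h.offset • h.normal))) := by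
        obtain ⟨C, hC⟩ := (BoundedRep.expForm (U := V) (h.offset • h.normal)).2 z hz
        exact isBoundedUnder_of ⟨C, fun t => hC _⟩
      simpa using (isBoundedUnder_le_mul_tendsto_zero h3 h2).const_mul ((-⟪h.normal, v⟫ : ℝ) : ℂ)
    refine h1.congr fun t => ?_
    rw [neg_eq_iff_add_eq_zero, add_comm]
    have h2 := hsum _ (add_imagFreq_mem hz (t • innerSL ℝ h₀.normal))
    rw [← Finset.sum_filter_add_sum_filter_not H fun h => h.normal = h₀.normal] at h2
    rw [← h2]
    congr 1
    · refine Finset.sum_congr rfl fun h hh => ?_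
      have hn := (Finset.mem_filter.1 hh).2
      have h3 : (z + imagFreq (t • innerSL ℝ h₀.normal)) (h.offset • h.normal) =
          z (h.offset • h.normal) + Complex.I * (t * h.offset : ℝ) := by
        rw [add_apply, imagFreq_apply, smul_apply,
          innerSL_apply_apply, inner_smul_right, ← hn, h.inner_normal_self, mul_one, smul_eq_mul]
      have h4 : imagFreq (t • innerSL ℝ (0 : h.Space)) = 0 := by
        ext y
        simp
      rw [restrictFreq_add_imagFreq (ha h), heq h hn, h4, add_zero, h3, Complex.exp_add]
      ring
    · refine Finset.sum_congr rfl fun h _ => ?_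
      rw [restrictFreq_add_imagFreq (ha h)]
  -- Hyperplanes with a common normal are told apart by their offsets, so the frequencies are
  -- distinct.
  have hfin := eq_zero_of_tendsto_sum_exp _ (c := OrientedHyperplane.offset) (by
    intro h hh h' hh' ho
    have h1 := (Finset.mem_filter.1 (Finset.mem_coe.1 hh)).2
    have h2 := (Finset.mem_filter.1 (Finset.mem_coe.1 hh')).2
    exact OrientedHyperplane.ext_normal_offset (h1.trans h2.symm) ho) hmain h₀
    (Finset.mem_filter.2 ⟨hh₀, rfl⟩)
  have h5 : ((-⟪h₀.normal, v⟫ : ℝ) : ℂ) ≠ 0 :=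
    Complex.ofReal_ne_zero.2 (neg_ne_zero.2 hnv.ne')
  exact (mul_eq_zero.1 ((mul_eq_zero.1 hfin).resolve_left h5)).resolve_left (Complex.exp_ne_zero _)

theorem fourierLaplace_eq_zero_of_signedSection [Nontrivial E] {f : E → ℝ}
    (hf : f ∈ polyhedralFunctions E)
    (h0 : ∀ h : OrientedHyperplane E, fourierLaplace (signedSection f h) = 0) :
    fourierLaplace f = 0 := by
  obtain ⟨a₀, ha₀⟩ := exists_ne (0 : E)
  obtain ⟨s, hs⟩ := exists_fourierLaplace_eq_stokesSum hf
  obtain ⟨v, hv, -, H, hH, hc⟩ := exists_direction s a₀ ha₀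
  rw [hs v hv H hH hc]
  exact stokesSum_eq_zero v H fun h _ => h0 h

end Vanishing

end PolyhedraAlgebra

theorem mainTheorem5 (d : ℕ) (hd : 1 ≤ d) (f : EuclideanSpace ℝ (Fin d) → ℝ)
    (hf : f ∈ PolyhedraAlgebra.polyhedralFunctions (EuclideanSpace ℝ (Fin d))) :
    PolyhedraAlgebra.fourierLaplace f = 0 ↔
      ∀ h : PolyhedraAlgebra.OrientedHyperplane (EuclideanSpace ℝ (Fin d)),
        PolyhedraAlgebra.fourierLaplace (PolyhedraAlgebra.signedSection f h) = 0 := by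
  have : Nontrivial (EuclideanSpace ℝ (Fin d)) := Module.nontrivial_of_finrank_pos (R := ℝ)
    (by rw [finrank_euclideanSpace_fin]; exact hd)
  exact ⟨fun h => PolyhedraAlgebra.fourierLaplace_signedSection_eq_zero hf h,
    PolyhedraAlgebra.fourierLaplace_eq_zero_of_signedSection hf⟩
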